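/- **Conventions.** Let $V$ be a seven-dimensional vector space over $\mathbb{F}\in\{\mathbb{R},\mathbb{C}\}$. For a basis $e_1,\dots,e_7$ of $V$ with dual basis $e^1,\dots,e^7$ write $e^{ijk}=e^i\wedge e^j\wedge e^k$, etc. For $\mathbb{F}=\mathbb{R}$, a three-form $\varphi\in\Lambda^3V^*$ is a $G_2$-structure if $$\varphi=e^{127}+e^{347}+e^{567}+e^{135}-e^{146}-e^{236}-e^{245}$$ for some basis, and a $G_2^*$-structure if $$\varphi=-e^{127}-e^{347}+e^{567}+e^{135}-e^{146}-e^{236}-e^{245}$$ for some basis; such a basis is called adapted. In both cases $\varphi$ induces a unique (pseudo-)Euclidean metric $g$ and metric volume form $\mathrm{vol}$ on $V$ with $$g(v,w)\,\mathrm{vol}=\tfrac16\,(v\lrcorner\varphi)\wedge(w\lrcorner\varphi)\wedge\varphi\qquad(v,w\in V)\qquad(1)$$ for which every adapted basis is an oriented orthonormal basis. For $\mathbb{F}=\mathbb{C}$, a $(G_2)_{\mathbb{C}}$-structure is a pair $(\varphi,\mathrm{vol})\in\Lambda^3V^*\times\Lambda^7V^*$ for which there is a complex basis with $\mathrm{vol}=e^{1234567}$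 and $\varphi=e^{127}+e^{347}+e^{567}+e^{135}-e^{146}-e^{236}-e^{245}$; it induces a non-degenerate symmetric complex bilinear form $g$ by (1). In all cases the Hodge dual $\star_\varphi\varphi\in\Lambda^4V^*$ is the four-form with $\varphi\wedge\phi=g(\star_\varphi\varphi,\phi)\,\mathrm{vol}$ for all $\phi\in\Lambda^4V^*$, where $g$ also denotes the induced form on $\Lambda^4V^*$. If $V$ is (the vector space underlying) a Lie algebra, the structure is called cocalibrated if $d\star_\varphi\varphi=0$, where $d$ is the Chevalley–Eilenberg differential, $(d\alpha)(X,Y)=-\alpha([X,Y])$ on one-forms. A subspace $U\subseteq V$ is non-degenerate if $g|_{U\times U}$ is non-degenerate. **Statement.** Let $\mathfrak{g}$ be a seven-dimensional real Lie algebra with a six-dimensional Abelian ideal $\mathfrak{u}$. Then: (a) If $\mathfrak{g}$ admits a cocalibrated $G_2$-structure, then it also admits a cocalibrated $G_2^*$-structure. (b) $\mathfrak{g}$ admits a cocalibrated $G_2$-structure if and only if $\mathfrak{g}$ admits a cocalibrated $G_2^*$-structure such that $\mathfrak{u}$ is non-degenerate with respect to the induced pseudo-Euclidean metric. (c) The complexification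 $\mathfrak{g}_{\mathbb{C}}$ admits a cocalibrated $(G_2)_{\mathbb{C}}$-structure if and only if $\mathfrak{g}$ admits a cocalibrated $G_2^*$-structure. Moreover, $\mathfrak{g}_{\mathbb{C}}$ admits a cocalibrated $(G_2)_{\mathbb{C}}$-structure such that $\mathfrak{u}_{\mathbb{C}}$ is non-degenerate with respect to the induced symmetric complex bilinear form if and only if $\mathfrak{g}$ admits a cocalibrated $G_2^*$-structure such that $\mathfrak{u}$ is non-degenerate with respect to the induced pseudo-Euclidean metric, and this is the case if and only if $\mathfrak{g}$ admits a cocalibrated $G_2$-structure. -/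

import Mathlib

open scoped TensorProduct

noncomputable section

namespace CocalibratedG2

/-! ### Multilinear algebra of alternating forms

A `k`-form on a `K`-vector space `V` is an alternating map `V [⋀^Fin k]→ₗ[K] K`. -/

section Forms

variable {K V : Type*} [Field K] [AddCommGroup V] [Module K V]

/-- The decomposable form `α₁ ∧ ⋯ ∧ αₖ`, i.e. `(v₁, …, vₖ) ↦ det (αⱼ (vᵢ))`. -/
def wedgeCovectors {k : ℕ} (α : Fin k → Module.Dual K V) : V [⋀^Fin k]→ₗ[K] K :=
  (Matrix.detRowAlternating (R := K) (n := Fin k)).compLinearMap (LinearMap.pi α)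

theorem wedgeCovectors_apply {k : ℕ} (α : Fin k → Module.Dual K V) (v : Fin k → V) :
    wedgeCovectors α v = (Matrix.of fun i j => α j (v i)).det := rfl

/-- The wedge product of a `k`-form and an `l`-form (the signed sum over all `(k, l)`-shuffles, so
that it is compatible with `wedgeCovectors`). -/
def wedge {k l : ℕ} (α : V [⋀^Fin k]→ₗ[K] K) (β : V [⋀^Fin l]→ₗ[K] K) :
    V [⋀^Fin (k + l)]→ₗ[K] K :=
  ((LinearMap.mul' K K).compAlternatingMap (α.domCoprod β)).domDomCongr finSumFinEquiv

/-- For a basis `e₁, …, eₙ` with dual basis `e¹, …, eⁿ`: the form `e^{I(1)} ∧ ⋯ ∧ e^{I(k)}`.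
Indices start at `0`, so `e^{127}` is `coordForm e ![0, 1, 6]`. -/
def coordForm {n k : ℕ} (e : Module.Basis (Fin n) K V) (I : Fin k → Fin n) :
    V [⋀^Fin k]→ₗ[K] K :=
  wedgeCovectors fun a => e.coord (I a)

/-- `G` is the bilinear form on `k`-forms induced by the non-degenerate symmetric bilinear form `g`
on `V`: on decomposable forms it is given by Gram determinants,
`G (α₁ ∧ ⋯ ∧ αₖ, β₁ ∧ ⋯ ∧ βₖ) = det (g (αᵢ, βⱼ))`, where covectors are written as
`αᵢ = g (vᵢ, ·)`, `βⱼ = g (wⱼ, ·)`, so that `g (αᵢ, βⱼ) = g (vᵢ, wⱼ)`. -/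
def IsInducedOnForms {k : ℕ} (g : LinearMap.BilinForm K V)
    (G : LinearMap.BilinForm K (V [⋀^Fin k]→ₗ[K] K)) : Prop :=
  ∀ v w : Fin k → V,
    G (wedgeCovectors fun i => g (v i)) (wedgeCovectors fun j => g (w j)) =
      (Matrix.of fun i j => g (v i) (w j)).det

/-- `χ` is the Hodge dual `⋆ψ` of the `k`-form `ψ` with respect to the non-degenerate symmetric
bilinear form `g` and the volume form `vol`: `ψ ∧ φ = g (⋆ψ, φ) vol` for all `l`-forms `φ`. -/
def IsHodgeDual {k l : ℕ} (g : LinearMap.BilinForm K V) (vol : V [⋀^Fin (k + l)]→ₗ[K] K)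
    (ψ : V [⋀^Fin k]→ₗ[K] K) (χ : V [⋀^Fin l]→ₗ[K] K) : Prop :=
  ∃ G : LinearMap.BilinForm K (V [⋀^Fin l]→ₗ[K] K),
    IsInducedOnForms g G ∧ ∀ φ : V [⋀^Fin l]→ₗ[K] K, wedge ψ φ = G χ φ • vol

/-- The relation `g(v, w) vol = (1/6) (v ⌟ φ) ∧ (w ⌟ φ) ∧ φ` for all `v, w`. -/
def MetricRelation (φ : V [⋀^Fin 3]→ₗ[K] K) (g : LinearMap.BilinForm K V)
    (vol : V [⋀^Fin 7]→ₗ[K] K) : Prop :=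
  ∀ v w : V, g v w • vol = (6 : K)⁻¹ • wedge (wedge (φ.curryLeft v) (φ.curryLeft w)) φ

/-- `e^{127} + e^{347} + e^{567} + e^{135} - e^{146} - e^{236} - e^{245}`. -/
def g2Form (e : Module.Basis (Fin 7) K V) : V [⋀^Fin 3]→ₗ[K] K :=
  coordForm e ![0, 1, 6] + coordForm e ![2, 3, 6] + coordForm e ![4, 5, 6]
    + coordForm e ![0, 2, 4] - coordForm e ![0, 3, 5] - coordForm e ![1, 2, 5]
    - coordForm e ![1, 3, 4]

/-- `-e^{127} - e^{347} + e^{567} + e^{135} - e^{146} - e^{236} - e^{245}`. -/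
def g2StarForm (e : Module.Basis (Fin 7) K V) : V [⋀^Fin 3]→ₗ[K] K :=
  -coordForm e ![0, 1, 6] - coordForm e ![2, 3, 6] + coordForm e ![4, 5, 6]
    + coordForm e ![0, 2, 4] - coordForm e ![0, 3, 5] - coordForm e ![1, 2, 5]
    - coordForm e ![1, 3, 4]

end Forms

/-! ### `G₂`-, `G₂*`- and `(G₂)_ℂ`-structures on vector spaces -/

section Real

variable {V : Type*} [AddCommGroup V] [Module ℝ V]

/-- A `G₂`-structure on a real vector space (of dimension seven). -/
def IsG2Structure (φ : V [⋀^Fin 3]→ₗ[ℝ] ℝ) : Prop :=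
  ∃ e : Module.Basis (Fin 7) ℝ V, φ = g2Form e

/-- A `G₂*`-structure on a real vector space (of dimension seven). -/
def IsG2StarStructure (φ : V [⋀^Fin 3]→ₗ[ℝ] ℝ) : Prop :=
  ∃ e : Module.Basis (Fin 7) ℝ V, φ = g2StarForm e

/-- `g` and `vol` are the (pseudo-)Euclidean metric and the metric volume form induced by the
`G₂`- or `G₂*`-structure `φ`: they satisfy `g(v, w) vol = (1/6) (v ⌟ φ) ∧ (w ⌟ φ) ∧ φ`, and every
adapted basis of `φ` is an oriented orthonormal basis. -/
structure IsInducedMetric (φ : V [⋀^Fin 3]→ₗ[ℝ] ℝ) (g : LinearMap.BilinForm ℝ V)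
    (vol : V [⋀^Fin 7]→ₗ[ℝ] ℝ) : Prop where
  relation : MetricRelation φ g vol
  orthonormal : ∀ e : Module.Basis (Fin 7) ℝ V, φ = g2Form e ∨ φ = g2StarForm e →
    vol e = 1 ∧ ∀ i j : Fin 7, |g (e i) (e j)| = if i = j then 1 else 0

end Real

section Complex

variable {W : Type*} [AddCommGroup W] [Module ℂ W]

/-- A `(G₂)_ℂ`-structure on a complex vector space (of dimension seven). -/
def IsG2ComplexStructure (φ : W [⋀^Fin 3]→ₗ[ℂ] ℂ) (vol : W [⋀^Fin 7]→ₗ[ℂ] ℂ) : Prop :=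
  ∃ e : Module.Basis (Fin 7) ℂ W, vol = coordForm e id ∧ φ = g2Form e

end Complex

/-! ### Cocalibrated structures on Lie algebras -/

section LieAlgebra

variable {K 𝔤 : Type*} [Field K] [LieRing 𝔤] [LieAlgebra K 𝔤]

/-- The exterior derivative of a form of positive degree on a Lie algebra (the Chevalley–Eilenberg
differential with trivial coefficients), as a function of its arguments:
`dα (v₀, …, vₘ) = ∑_{i < j} (-1)^{i + j} α (⁅vᵢ, vⱼ⁆, v₀, …, v̂ᵢ, …, v̂ⱼ, …, vₘ)`.
In particular `dα (X, Y) = -α ⁅X, Y⁆` for a one-form `α`. -/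
def lieExtDeriv {k : ℕ} (α : 𝔤 [⋀^Fin (k + 1)]→ₗ[K] K) (v : Fin (k + 2) → 𝔤) : K :=
  ∑ j : Fin (k + 2), ∑ i : Fin (k + 1),
    if i.castSucc < j then
      (-1) ^ ((i : ℕ) + (j : ℕ)) *
        α (Fin.cons ⁅v i.castSucc, v j⁆ (i.removeNth (j.removeNth v)))
    else 0

/-- The Hodge dual of the three-form `φ` with respect to `g` and `vol` is closed. -/
def HasClosedHodgeDual (g : LinearMap.BilinForm K 𝔤) (vol : 𝔤 [⋀^Fin 7]→ₗ[K] K)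
    (φ : 𝔤 [⋀^Fin 3]→ₗ[K] K) : Prop :=
  ∃ Ψ : 𝔤 [⋀^Fin 4]→ₗ[K] K, IsHodgeDual g vol φ Ψ ∧ lieExtDeriv Ψ = 0

end LieAlgebra

/-- `φ` is a cocalibrated `G₂`-structure on the real Lie algebra `𝔤`, with induced metric `g` and
volume form `vol`. -/
def IsCocalibratedG2 {𝔤 : Type*} [LieRing 𝔤] [LieAlgebra ℝ 𝔤] (φ : 𝔤 [⋀^Fin 3]→ₗ[ℝ] ℝ)
    (g : LinearMap.BilinForm ℝ 𝔤) (vol : 𝔤 [⋀^Fin 7]→ₗ[ℝ] ℝ) : Prop :=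
  IsG2Structure φ ∧ IsInducedMetric φ g vol ∧ HasClosedHodgeDual g vol φ

/-- `φ` is a cocalibrated `G₂*`-structure on the real Lie algebra `𝔤`, with induced metric `g` and
volume form `vol`. -/
def IsCocalibratedG2Star {𝔤 : Type*} [LieRing 𝔤] [LieAlgebra ℝ 𝔤] (φ : 𝔤 [⋀^Fin 3]→ₗ[ℝ] ℝ)
    (g : LinearMap.BilinForm ℝ 𝔤) (vol : 𝔤 [⋀^Fin 7]→ₗ[ℝ] ℝ) : Prop :=
  IsG2StarStructure φ ∧ IsInducedMetric φ g vol ∧ HasClosedHodgeDual g vol φ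

/-- `(φ, vol)` is a cocalibrated `(G₂)_ℂ`-structure on the complex Lie algebra `𝔤`, with induced
complex symmetric bilinear form `g` (which is determined by the relation, as `vol ≠ 0`). -/
def IsCocalibratedG2Complex {𝔤 : Type*} [LieRing 𝔤] [LieAlgebra ℂ 𝔤] (φ : 𝔤 [⋀^Fin 3]→ₗ[ℂ] ℂ)
    (g : LinearMap.BilinForm ℂ 𝔤) (vol : 𝔤 [⋀^Fin 7]→ₗ[ℂ] ℂ) : Prop :=
  IsG2ComplexStructure φ vol ∧ MetricRelation φ g vol ∧ HasClosedHodgeDual g vol φ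

/-- `𝔤` admits a cocalibrated `G₂`-structure. -/
def AdmitsCocalibratedG2 (𝔤 : Type*) [LieRing 𝔤] [LieAlgebra ℝ 𝔤] : Prop :=
  ∃ φ g vol, IsCocalibratedG2 (𝔤 := 𝔤) φ g vol

/-- `𝔤` admits a cocalibrated `G₂*`-structure. -/
def AdmitsCocalibratedG2Star (𝔤 : Type*) [LieRing 𝔤] [LieAlgebra ℝ 𝔤] : Prop :=
  ∃ φ g vol, IsCocalibratedG2Star (𝔤 := 𝔤) φ g vol

/-- `𝔤` admits a cocalibrated `G₂*`-structure for whose induced metric `𝔲` is non-degenerate. -/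
def AdmitsCocalibratedG2StarNondeg (𝔤 : Type*) [LieRing 𝔤] [LieAlgebra ℝ 𝔤]
    (𝔲 : Submodule ℝ 𝔤) : Prop :=
  ∃ φ g vol, IsCocalibratedG2Star (𝔤 := 𝔤) φ g vol ∧ (g.restrict 𝔲).Nondegenerate

/-- `𝔤` admits a cocalibrated `(G₂)_ℂ`-structure. -/
def AdmitsCocalibratedG2Complex (𝔤 : Type*) [LieRing 𝔤] [LieAlgebra ℂ 𝔤] : Prop :=
  ∃ φ g vol, IsCocalibratedG2Complex (𝔤 := 𝔤) φ g vol

/-- `𝔤` admits a cocalibrated `(G₂)_ℂ`-structure for whose induced symmetric complex bilinear form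
`𝔲` is non-degenerate. -/
def AdmitsCocalibratedG2ComplexNondeg (𝔤 : Type*) [LieRing 𝔤] [LieAlgebra ℂ 𝔤]
    (𝔲 : Submodule ℂ 𝔤) : Prop :=
  ∃ φ g vol, IsCocalibratedG2Complex (𝔤 := 𝔤) φ g vol ∧ (g.restrict 𝔲).Nondegenerate

end CocalibratedG2

end

noncomputable section

namespace CocalibratedG2

/-! ### Wedge products and contractions of coordinate forms, computed on lists of terms. -/

section Forms

variable {K V : Type*} [Field K] [AddCommGroup V] [Module K V]

/-! Choose a covector `ξ` with kernel `𝔲`, a vector `X` with `ξ X = 1`, and put `A = ad X`. As `𝔲`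
is an Abelian ideal, `⁅v, w⁆ = ξ v • A w - ξ w • A v` and `ξ ∘ A = 0`
(`exists_covector_of_abelian_ideal`). Hence the derivative of a four-form `Ψ` is, up to sign, `ξ`
wedged with the action of `A` on `Ψ`, and only `Ψ` restricted to `𝔲` matters. Under Λ⁴𝔲* ≅ Λ²𝔲 ⊗
Λ⁶𝔲* the restriction of the Hodge dual of `φ` becomes the bivector `B` got by contracting `φ` with
`ξ`, and closedness becomes `A · B = tr(A) B`, the trace coming from the factor Λ⁶𝔲*
(`hasClosedHodgeDual_phi_iff`).

It remains to see which bivectors occur. `B` always has rank at least four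
(`exists_pfaffian4_phiBivec_ne_zero`), and rank six if `ξ` is non-null, that is, if `𝔲` is
non-degenerate (`phiBivec_radical`, `metric_ker_nondegenerate_iff`); for a `G₂`-structure this is
automatic. Over any field, Darboux bases and a rescaling leave two normal forms, `f₀∧f₁ + f₂∧f₃ + c
f₄∧f₅` with `c = 1` or `c = 0`. The first is realised by both kinds of form with `ξ` non-null
(`HasNormalForm.exists_phiBivec`), the second, up to a scalar that the linear equation ignores, by a
`G₂*`-form with `ξ` null (`HasNormalForm.exists_phiBivec_neg_one`). Over `ℂ` a `G₂*`-form is a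
`G₂`-form in a rescaled basis. So `HasNormalForm 1` characterises `G₂`, non-degenerate `G₂*` and
non-degenerate `(G₂)_ℂ`, while `HasNormalForm 1 ∨ HasNormalForm 0` characterises `G₂*` and `(G₂)_ℂ`.

What is left is descent from `ℂ` to `ℝ`. For a complex solution `B` of this real linear equation, Re
`B` + t Im `B` on real covectors is a real solution for every real `t`. The Pfaffian or determinant
measuring its rank is a polynomial in `t` that is non-zero at `t = i`, where the form is `B` itself,
so it is non-zero at some real `t` (`HasNormalForm.of_baseChange`,
`HasNormalForm.one_of_baseChange`). -/

theorem wedgeCovectors_eq_alternatization {k : ℕ} (α : Fin k → Module.Dual K V) :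
    wedgeCovectors α = MultilinearMap.alternatization
      ((MultilinearMap.mkPiAlgebra K (Fin k) K).compLinearMap α) := by
  ext v
  simp [wedgeCovectors_apply, Matrix.det_apply, MultilinearMap.alternatization_apply]

theorem wedgeCovectors_eq_sum {k : ℕ} (α : Fin k → Module.Dual K V) (v : Fin k → V) :
    wedgeCovectors α v = ∑ σ : Equiv.Perm (Fin k), Equiv.Perm.sign σ • ∏ i, α i (v (σ i)) := by
  simp [wedgeCovectors_apply, Matrix.det_apply]

/-- Both factors are alternatizations of plain products of covectors. Their shuffle product is
therefore a single alternatization over `Fin k ⊕ Fin l`, which `finSumFinEquiv` turns into the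
determinant sum. -/
theorem wedge_wedgeCovectors {k l : ℕ} (α : Fin k → Module.Dual K V)
    (β : Fin l → Module.Dual K V) :
    wedge (wedgeCovectors α) (wedgeCovectors β) = wedgeCovectors (Fin.append α β) := by
  ext v
  rw [wedgeCovectors_eq_sum, wedge, wedgeCovectors_eq_alternatization,
    wedgeCovectors_eq_alternatization, ← MultilinearMap.domCoprod_alternization]
  simp only [AlternatingMap.domDomCongr_apply, LinearMap.compAlternatingMap_apply,
    MultilinearMap.alternatization_apply, map_sum]
  refine Fintype.sum_equiv finSumFinEquiv.permCongr _ _ fun σ => ?_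
  rw [Equiv.Perm.sign_permCongr, Units.smul_def, Units.smul_def, map_zsmul]
  congr 1
  simp [MultilinearMap.domDomCongr_apply, MultilinearMap.domCoprod_apply,
    ← finSumFinEquiv.prod_comp, Fintype.prod_sum_type, Equiv.permCongr_apply]

/-- The wedge product as a bilinear map. -/
def wedgeBilin (K V : Type*) [Field K] [AddCommGroup V] [Module K V] (k l : ℕ) :
    (V [⋀^Fin k]→ₗ[K] K) →ₗ[K] (V [⋀^Fin l]→ₗ[K] K) →ₗ[K] (V [⋀^Fin (k + l)]→ₗ[K] K) :=
  LinearMap.mk₂ K wedge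
    (fun α α' β => by
      ext v
      simp only [wedge, ← AlternatingMap.domCoprod'_apply, TensorProduct.add_tmul, map_add]
      simp)
    (fun c α β => by
      ext v
      simp only [wedge, ← AlternatingMap.domCoprod'_apply, ← TensorProduct.smul_tmul', map_smul]
      simp)
    (fun α β β' => by
      ext v
      simp only [wedge, ← AlternatingMap.domCoprod'_apply, TensorProduct.tmul_add, map_add]
      simp)
    (fun c α β => by
      ext v
      simp only [wedge, ← AlternatingMap.domCoprod'_apply, TensorProduct.tmul_smul, map_smul]
      simp)

theorem wedgeBilin_apply {k l : ℕ} (α : V [⋀^Fin k]→ₗ[K] K) (β : V [⋀^Fin l]→ₗ[K] K) :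
    wedgeBilin K V k l α β = wedge α β := rfl

theorem wedge_coordForm {n k l : ℕ} (e : Module.Basis (Fin n) K V) (I : Fin k → Fin n)
    (J : Fin l → Fin n) :
    wedge (coordForm e I) (coordForm e J) = coordForm e (Fin.append I J) := by
  rw [coordForm, coordForm, wedge_wedgeCovectors, coordForm]
  congr 1
  ext1 a
  refine Fin.addCases (fun i => ?_) (fun i => ?_) a <;> simp

/-- The sign of a self-map of `Fin n`, with value `0` on maps that are not injective. -/
def tupleSign {n : ℕ} (I : Fin n → Fin n) : ℤ :=
  ∏ i, ∏ j ∈ Finset.Ioi i, if I i < I j then 1 else if I j < I i then -1 else 0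

/-- The sign of a list of natural numbers, with value `0` on lists with repetitions. -/
def listSign : List ℕ → ℤ
  | [] => 1
  | a :: l => if l.elem a then 0 else (-1) ^ l.countP (· < a) * listSign l

theorem prod_ofFn_eq_listSign {n : ℕ} (I : Fin n → ℕ) :
    (∏ i, ∏ j ∈ Finset.Ioi i, if I i < I j then (1 : ℤ) else if I j < I i then -1 else 0) =
      listSign (List.ofFn I) := by
  induction n with
  | zero => simp [listSign]
  | succ n ih =>
    have h (a : ℕ) (l : List ℕ) :
        (l.map fun b => if a < b then (1 : ℤ) else if b < a then -1 else 0).prod =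
          if l.elem a then 0 else (-1) ^ l.countP (· < a) := by
      induction l with
      | nil => simp
      | cons b l ih =>
        rw [List.map_cons, List.prod_cons, ih]
        rcases lt_trichotomy a b with hab | rfl | hab
        · simp [hab, hab.ne, hab.not_gt]
        · simp
        · by_cases hl : a ∈ l <;> simp [hab, hab.ne', hab.not_gt, hl, pow_succ]
    rw [Fin.prod_univ_succ, List.ofFn_succ, listSign, ← ih, Fin.prod_Ioi_zero]
    simp_rw [Fin.prod_Ioi_succ]
    have h0 := h (I 0) (List.ofFn fun i => I i.succ)
    rw [List.map_ofFn, List.prod_ofFn] at h0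
    simp only [Function.comp_apply] at h0
    rw [h0]
    split_ifs <;> simp

/-- The recursive form is the one used to evaluate signs in the finite checks `phiTerms_metric` and
`phiTerms_hodge`. -/
theorem tupleSign_eq_listSign {n : ℕ} (I : Fin n → Fin n) :
    tupleSign I = listSign (List.ofFn fun i => (I i : ℕ)) := by
  rw [← prod_ofFn_eq_listSign]
  rfl

theorem coordForm_apply_basis {n : ℕ} (e : Module.Basis (Fin n) K V) (I : Fin n → Fin n) :
    coordForm e I e = (tupleSign I : K) := by
  by_cases hI : Function.Injective I
  · obtain ⟨σ, rfl⟩ : ∃ σ : Equiv.Perm (Fin n), (σ : Fin n → Fin n) = I :=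
      ⟨Equiv.ofBijective I (Finite.injective_iff_bijective.1 hI), rfl⟩
    have h1 : (tupleSign (σ : Fin n → Fin n)) = ((Equiv.Perm.sign σ : ℤˣ) : ℤ) := by
      rw [tupleSign, Equiv.Perm.sign_eq_prod_prod_Ioi]
      push_cast
      refine Finset.prod_congr rfl fun i _ => Finset.prod_congr rfl fun j hj => ?_
      have : σ i ≠ σ j := fun h => (Finset.mem_Ioi.1 hj).ne (σ.injective h)
      rcases lt_or_gt_of_ne this with h | h
      · simp [h]
      · simp [h, h.not_gt]
    rw [h1]
    have h2 := Matrix.det_permutation (R := K) σ⁻¹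
    rw [coordForm, wedgeCovectors_apply]
    rw [Equiv.Perm.sign_inv] at h2
    rw [← h2]
    congr 1
    ext i j
    simp [PEquiv.toMatrix_apply, Finsupp.single_apply, eq_comm, Equiv.eq_symm_apply]
  · obtain ⟨i, j, hij, hne⟩ : ∃ i j, I i = I j ∧ i ≠ j := by
      simpa [Function.Injective] using hI
    have h1 : tupleSign I = 0 := by
      wlog h : i < j generalizing i j
      · exact this j i hij.symm hne.symm (lt_of_le_of_ne (not_lt.1 h) hne.symm)
      refine Finset.prod_eq_zero (Finset.mem_univ i)
        (Finset.prod_eq_zero (Finset.mem_Ioi.2 h) ?_)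
      simp [hij]
    rw [h1, coordForm, wedgeCovectors_apply, Int.cast_zero]
    exact Matrix.det_zero_of_column_eq hne (by simp [hij])

/-- Evaluation of `k`-forms at a tuple of vectors, as a linear map. -/
def evalForm (K : Type*) {V : Type*} [Field K] [AddCommGroup V] [Module K V] {k : ℕ}
    (v : Fin k → V) : (V [⋀^Fin k]→ₗ[K] K) →ₗ[K] K where
  toFun α := α v
  map_add' _ _ := rfl
  map_smul' _ _ := rfl

theorem evalForm_apply {k : ℕ} (v : Fin k → V) (α : V [⋀^Fin k]→ₗ[K] K) :
    evalForm K v α = α v := rfl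

/-- Laplace expansion of the determinant along its first row, which carries `v`. -/
theorem curryLeft_wedgeCovectors {k : ℕ} (α : Fin (k + 1) → Module.Dual K V) (v : V) :
    (wedgeCovectors α).curryLeft v =
      ∑ m : Fin (k + 1), ((-1) ^ (m : ℕ) * α m v) • wedgeCovectors (α ∘ m.succAbove) := by
  ext w
  rw [AlternatingMap.curryLeft_apply_apply, wedgeCovectors_apply, Matrix.det_succ_row_zero,
    ← evalForm_apply, map_sum]
  rfl

/-- The integral combination of coordinate forms given by a list of coefficients and indices. -/
def formOfList {n k : ℕ} (e : Module.Basis (Fin n) K V) (L : List (ℤ × (Fin k → Fin n))) :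
    V [⋀^Fin k]→ₗ[K] K :=
  (L.map fun p => (p.1 : K) • coordForm e p.2).sum

/-- The list of terms of the wedge product. -/
def wedgeTerms {n k l : ℕ} (L : List (ℤ × (Fin k → Fin n))) (M : List (ℤ × (Fin l → Fin n))) :
    List (ℤ × (Fin (k + l) → Fin n)) :=
  L.flatMap fun p => M.map fun q => (p.1 * q.1, Fin.append p.2 q.2)

/-- The list of terms of the contraction with the `i`-th basis vector. -/
def contractTerms {n k : ℕ} (i : Fin n) (L : List (ℤ × (Fin (k + 1) → Fin n))) :
    List (ℤ × (Fin k → Fin n)) :=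
  L.flatMap fun p => (List.finRange (k + 1)).filterMap fun m : Fin (k + 1) =>
    if p.2 m = i then some ((-1) ^ (m : ℕ) * p.1, p.2 ∘ m.succAbove) else none

theorem formOfList_nil {n k : ℕ} (e : Module.Basis (Fin n) K V) :
    formOfList e ([] : List (ℤ × (Fin k → Fin n))) = 0 := rfl

theorem formOfList_cons {n k : ℕ} (e : Module.Basis (Fin n) K V) (p : ℤ × (Fin k → Fin n))
    (L : List (ℤ × (Fin k → Fin n))) :
    formOfList e (p :: L) = (p.1 : K) • coordForm e p.2 + formOfList e L := by
  simp [formOfList]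

theorem formOfList_append {n k : ℕ} (e : Module.Basis (Fin n) K V)
    (L M : List (ℤ × (Fin k → Fin n))) :
    formOfList e (L ++ M) = formOfList e L + formOfList e M := by
  simp [formOfList]

theorem wedge_formOfList {n k l : ℕ} (e : Module.Basis (Fin n) K V)
    (L : List (ℤ × (Fin k → Fin n))) (M : List (ℤ × (Fin l → Fin n))) :
    wedge (formOfList e L) (formOfList e M) = formOfList e (wedgeTerms L M) := by
  have key (p : ℤ × (Fin k → Fin n)) : wedge ((p.1 : K) • coordForm e p.2) (formOfList e M) =
      formOfList e (M.map fun q => (p.1 * q.1, Fin.append p.2 q.2)) := by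
    induction M with
    | nil => rw [formOfList_nil, ← wedgeBilin_apply, map_zero]; rfl
    | cons q M ih =>
      rw [formOfList_cons, List.map_cons, formOfList_cons, ← ih, ← wedgeBilin_apply, map_add,
        map_smul, map_smul, LinearMap.smul_apply, wedgeBilin_apply, wedge_coordForm, smul_smul,
        ← wedgeBilin_apply, map_smul, LinearMap.smul_apply]
      push_cast
      rw [mul_comm]
  induction L with
  | nil => rw [formOfList_nil, ← wedgeBilin_apply, map_zero]; rfl
  | cons p L ih =>
    rw [wedgeTerms, List.flatMap_cons, formOfList_append, ← key, formOfList_cons,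
      ← wedgeBilin_apply, map_add, LinearMap.add_apply, wedgeBilin_apply, wedgeBilin_apply, ih]
    rfl

theorem curryLeft_formOfList {n k : ℕ} (e : Module.Basis (Fin n) K V)
    (L : List (ℤ × (Fin (k + 1) → Fin n))) (i : Fin n) :
    (formOfList e L).curryLeft (e i) = formOfList e (contractTerms i L) := by
  induction L with
  | nil => rfl
  | cons p L ih =>
    have h : ∀ l : List (Fin (k + 1)), formOfList e (l.filterMap fun m : Fin (k + 1) =>
        if p.2 m = i then some ((-1) ^ (m : ℕ) * p.1, p.2 ∘ m.succAbove) else none) =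
        (l.map fun m : Fin (k + 1) => (p.1 : K) • ((-1) ^ (m : ℕ) * e.coord (p.2 m) (e i)) •
          coordForm e (p.2 ∘ m.succAbove)).sum := by
      intro l
      induction l with
      | nil => rfl
      | cons m l ih =>
        by_cases hm : p.2 m = i
        · rw [List.filterMap_cons_some (by rw [if_pos hm]), formOfList_cons, ih, List.map_cons,
            List.sum_cons, ← hm]
          simp [smul_smul, mul_comm]
        · rw [List.filterMap_cons_none (by rw [if_neg hm]), ih, List.map_cons, List.sum_cons]
          simp [Finsupp.single_apply, Ne.symm hm]
    rw [contractTerms, List.flatMap_cons, formOfList_append, h, formOfList_cons,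
      AlternatingMap.curryLeft_add, LinearMap.add_apply, ih]
    congr 1
    rw [AlternatingMap.curryLeft_smul, LinearMap.smul_apply, coordForm, curryLeft_wedgeCovectors,
      Finset.smul_sum]
    rw [← List.sum_toFinset _ (List.nodup_finRange _), List.toFinset_finRange]
    rfl

/-- Makes identities between top-degree forms a computation with integers, independent of field and
basis. -/
theorem formOfList_apply_basis {n : ℕ} (e : Module.Basis (Fin n) K V)
    (L : List (ℤ × (Fin n → Fin n))) :
    formOfList e L e = ((L.map fun p => p.1 * tupleSign p.2).sum : ℤ) := by
  induction L with
  | nil => simp [formOfList_nil]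
  | cons p L ih => simp [formOfList_cons, ih, coordForm_apply_basis]

end Forms

/-! ### The standard three-forms and their metric coefficients. -/

section Forms
variable {K V : Type*} [Field K] [AddCommGroup V] [Module K V]

/-- The terms of the three-form `s e^{127} + s e^{347} + e^{567} + e^{135} - e^{146} - e^{236}
- e^{245}`, which is the `G₂`-form for `s = 1` and the `G₂*`-form for `s = -1`. -/
def phiTerms (s : ℤ) : List (ℤ × (Fin 3 → Fin 7)) :=
  [(s, ![0, 1, 6]), (s, ![2, 3, 6]), (1, ![4, 5, 6]), (1, ![0, 2, 4]), (-1, ![0, 3, 5]),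
    (-1, ![1, 2, 5]), (-1, ![1, 3, 4])]

/-- The three-form `s e^{127} + s e^{347} + e^{567} + e^{135} - e^{146} - e^{236} - e^{245}`. -/
def phi (s : ℤ) (e : Module.Basis (Fin 7) K V) : V [⋀^Fin 3]→ₗ[K] K :=
  formOfList e (phiTerms s)

theorem phi_one (e : Module.Basis (Fin 7) K V) : phi 1 e = g2Form e := by
  simp only [phi, phiTerms, formOfList_cons, formOfList_nil, g2Form]
  push_cast
  module

theorem phi_neg_one (e : Module.Basis (Fin 7) K V) : phi (-1) e = g2StarForm e := by
  simp only [phi, phiTerms, formOfList_cons, formOfList_nil, g2StarForm]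
  push_cast
  module

/-- The sign of the `i`-th vector of an adapted basis. -/
def metricSign (s : ℤ) (i : Fin 7) : ℤ := if i < 4 then s else 1

theorem phiTerms_metric (s : ℤ) (hs : s = 1 ∨ s = -1) (i j : Fin 7) :
    ((wedgeTerms (wedgeTerms (contractTerms i (phiTerms s)) (contractTerms j (phiTerms s)))
      (phiTerms s)).map fun p => p.1 * tupleSign p.2).sum =
      if i = j then 6 * metricSign s i else 0 := by
  simp only [tupleSign_eq_listSign]
  rcases hs with rfl | rfl <;> revert i j <;> decide +kernel
end Forms

/-! ### Volume forms and the metric determined by the contraction formula. -/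

section Forms
variable {K V : Type*} [Field K] [AddCommGroup V] [Module K V]

theorem coordForm_id_apply {n : ℕ} (e : Module.Basis (Fin n) K V) (v : Fin n → V) :
    coordForm e id v = e.det v := by
  rw [coordForm, wedgeCovectors_apply, Module.Basis.det_apply, ← Matrix.det_transpose]
  rfl

theorem coordForm_id_eq_det {n : ℕ} (e : Module.Basis (Fin n) K V) :
    coordForm e id = e.det :=
  AlternatingMap.ext (coordForm_id_apply e)

theorem eq_smul_coordForm_id {n : ℕ} (e : Module.Basis (Fin n) K V) (α : V [⋀^Fin n]→ₗ[K] K) :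
    α = α e • coordForm e id := by
  rw [coordForm_id_eq_det]
  exact α.eq_smul_basis_det e

theorem topForm_ext {n : ℕ} (e : Module.Basis (Fin n) K V) {α β : V [⋀^Fin n]→ₗ[K] K}
    (h : α e = β e) : α = β := by
  rw [eq_smul_coordForm_id e α, eq_smul_coordForm_id e β, h]

theorem coordForm_id_self {n : ℕ} (e : Module.Basis (Fin n) K V) : coordForm e id e = 1 := by
  rw [coordForm_id_apply, e.det_self]

/-- The bilinear form for which `e` is orthonormal with signs `metricSign s`. -/
def metric (s : ℤ) (e : Module.Basis (Fin 7) K V) : LinearMap.BilinForm K V :=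
  ∑ i, (metricSign s i : K) • (LinearMap.mul K K).compl₁₂ (e.coord i) (e.coord i)

theorem metric_apply (s : ℤ) (e : Module.Basis (Fin 7) K V) (v w : V) :
    metric s e v w = ∑ i, (metricSign s i : K) * (e.coord i v * e.coord i w) := by
  simp [metric]

theorem metric_apply_basis (s : ℤ) (e : Module.Basis (Fin 7) K V) (i j : Fin 7) :
    metric s e (e i) (e j) = if i = j then (metricSign s i : K) else 0 := by
  rw [metric_apply, Finset.sum_eq_single i]
  · simp [Finsupp.single_apply, eq_comm]
  · intro k _ hk
    simp [Finsupp.single_apply, hk.symm]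
  · simp

theorem metric_basis_left (s : ℤ) (e : Module.Basis (Fin 7) K V) (i : Fin 7) (w : V) :
    metric s e (e i) w = metricSign s i * e.coord i w := by
  rw [metric_apply, Finset.sum_eq_single i]
  · simp
  · intro k _ hk
    simp [hk.symm]
  · simp

theorem metric_comm (s : ℤ) (e : Module.Basis (Fin 7) K V) (v w : V) :
    metric s e v w = metric s e w v := by
  simp [metric_apply, mul_comm]

theorem metricSign_mul_self {s : ℤ} (hs : s = 1 ∨ s = -1) (i : Fin 7) :
    metricSign s i * metricSign s i = 1 := by
  unfold metricSign
  rcases hs with rfl | rfl <;> split_ifs <;> rfl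

/-- The wedge product of two two-forms and a three-form, as a seven-form. -/
def wedge₂₂₃ (α β : V [⋀^Fin 2]→ₗ[K] K) (φ : V [⋀^Fin 3]→ₗ[K] K) : V [⋀^Fin 7]→ₗ[K] K :=
  wedge (wedge α β) φ

/-- The wedge product of a three-form and a four-form, as a seven-form. -/
def wedge₃₄ (φ : V [⋀^Fin 3]→ₗ[K] K) (ψ : V [⋀^Fin 4]→ₗ[K] K) : V [⋀^Fin 7]→ₗ[K] K :=
  wedge φ ψ

/-- The wedge product with a three-form, as a linear map from four-forms to seven-forms. -/
def wedge₃₄Linear (φ : V [⋀^Fin 3]→ₗ[K] K) :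
    (V [⋀^Fin 4]→ₗ[K] K) →ₗ[K] (V [⋀^Fin 7]→ₗ[K] K) :=
  wedgeBilin K V 3 4 φ

theorem wedge₃₄Linear_apply (φ : V [⋀^Fin 3]→ₗ[K] K) (ψ : V [⋀^Fin 4]→ₗ[K] K) :
    wedge₃₄Linear φ ψ = wedge₃₄ φ ψ := rfl

/-- The bilinear form `(v, w) ↦ (1/6) ((v ⌟ φ) ∧ (w ⌟ φ) ∧ φ) (u₁, …, u₇)`. -/
def contractionForm (φ : V [⋀^Fin 3]→ₗ[K] K) (u : Fin 7 → V) : LinearMap.BilinForm K V :=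
  ((wedgeBilin K V 2 2).compl₁₂ φ.curryLeft φ.curryLeft).compr₂
    ((6 : K)⁻¹ • (evalForm K u ∘ₗ (wedgeBilin K V 4 3).flip φ))

theorem contractionForm_apply (φ : V [⋀^Fin 3]→ₗ[K] K) (u : Fin 7 → V) (v w : V) :
    contractionForm φ u v w = (6 : K)⁻¹ * wedge₂₂₃ (φ.curryLeft v) (φ.curryLeft w) φ u := by
  simp only [wedge₂₂₃, contractionForm, LinearMap.compr₂_apply, LinearMap.compl₁₂_apply,
    LinearMap.smul_apply, LinearMap.comp_apply, LinearMap.flip_apply, evalForm_apply,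
    wedgeBilin_apply, smul_eq_mul]

/-- A seven-form is determined by its value on `e`, so the relation between forms is one equation of
bilinear forms. It determines `g` as soon as `vol e` is known and non-zero. -/
theorem metricRelation_iff (e : Module.Basis (Fin 7) K V) (φ : V [⋀^Fin 3]→ₗ[K] K)
    (g : LinearMap.BilinForm K V) (vol : V [⋀^Fin 7]→ₗ[K] K) :
    MetricRelation φ g vol ↔ vol e • g = contractionForm φ e := by
  have h : MetricRelation φ g vol ↔ ∀ v w, g v w • vol =
      (6 : K)⁻¹ • wedge₂₂₃ (φ.curryLeft v) (φ.curryLeft w) φ :=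
    -- The degrees `2 + 2 + 3` and `7` agree only by unfolding; this passes between the two types.
    ⟨fun h v w => (h v w).trans (congrArg₂ HSMul.hSMul rfl rfl),
      fun h v w => (h v w).trans (congrArg₂ HSMul.hSMul rfl rfl)⟩
  rw [h, LinearMap.ext_iff₂]
  refine forall₂_congr fun v w => ?_
  rw [contractionForm_apply, LinearMap.smul_apply, LinearMap.smul_apply, smul_eq_mul, mul_comm,
    ← smul_eq_mul, ← smul_eq_mul, ← AlternatingMap.smul_apply, ← AlternatingMap.smul_apply]
  exact ⟨fun h => congrArg (fun α => α e) h, topForm_ext e⟩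

theorem contractionForm_phi [CharZero K] {s : ℤ} (hs : s = 1 ∨ s = -1)
    (e : Module.Basis (Fin 7) K V) : contractionForm (phi s e) e = metric s e := by
  refine LinearMap.BilinForm.ext_basis e fun i j => ?_
  rw [contractionForm_apply, phi, curryLeft_formOfList, curryLeft_formOfList, wedge₂₂₃,
    wedge_formOfList, wedge_formOfList]
  have h := formOfList_apply_basis e (wedgeTerms (wedgeTerms (contractTerms i (phiTerms s))
    (contractTerms j (phiTerms s))) (phiTerms s))
  rw [phiTerms_metric s hs] at h
  rw [metric_apply_basis]
  refine (congrArg ((6 : K)⁻¹ * ·) h).trans ?_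
  split_ifs <;> simp

theorem metricRelation_phi [CharZero K] {s : ℤ} (hs : s = 1 ∨ s = -1)
    (e : Module.Basis (Fin 7) K V) :
    MetricRelation (phi s e) (metric s e) (coordForm e id) := by
  rw [metricRelation_iff e, contractionForm_phi hs, coordForm_id_self, one_smul]

theorem MetricRelation.eq_metric [CharZero K] {s : ℤ} (hs : s = 1 ∨ s = -1)
    {e : Module.Basis (Fin 7) K V} {g : LinearMap.BilinForm K V} {vol : V [⋀^Fin 7]→ₗ[K] K}
    (h : MetricRelation (phi s e) g vol) (hvol : vol e = 1) : g = metric s e := by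
  rwa [metricRelation_iff e, hvol, one_smul, contractionForm_phi hs] at h

/-! ### The induced bilinear form on forms -/

/-- The vector corresponding to a covector under `metric s e`. -/
def sharp (s : ℤ) (e : Module.Basis (Fin 7) K V) (α : Module.Dual K V) : V :=
  ∑ j, ((metricSign s j : K) * α (e j)) • e j

theorem coord_sharp (s : ℤ) (e : Module.Basis (Fin 7) K V) (α : Module.Dual K V) (i : Fin 7) :
    e.coord i (sharp s e α) = metricSign s i * α (e i) := by
  simp [sharp, Finsupp.single_apply]

theorem metric_sharp {s : ℤ} (hs : s = 1 ∨ s = -1) (e : Module.Basis (Fin 7) K V)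
    (α : Module.Dual K V) : metric s e (sharp s e α) = α := by
  refine e.ext fun i => ?_
  rw [metric_comm, metric_basis_left, coord_sharp, ← mul_assoc]
  have := metricSign_mul_self hs i
  rw [← Int.cast_mul, this, Int.cast_one, one_mul]

theorem sharp_metric {s : ℤ} (hs : s = 1 ∨ s = -1) (e : Module.Basis (Fin 7) K V) (v : V) :
    sharp s e (metric s e v) = v := by
  refine e.ext_elem fun i => ?_
  have := metricSign_mul_self hs i
  have h := coord_sharp s e (metric s e v) i
  rw [metric_comm, metric_basis_left, ← mul_assoc, ← Int.cast_mul, this, Int.cast_one,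
    one_mul] at h
  exact h

theorem sharp_coord (s : ℤ) (e : Module.Basis (Fin 7) K V) (i : Fin 7) :
    sharp s e (e.coord i) = (metricSign s i : K) • e i := by
  rw [sharp, Finset.sum_eq_single i]
  · simp
  · intro k _ hk
    simp [hk]
  · simp

/-- The bilinear form on `k`-forms induced by `metric s e`. -/
def inducedForm (s : ℤ) (e : Module.Basis (Fin 7) K V) (k : ℕ) :
    LinearMap.BilinForm K (V [⋀^Fin k]→ₗ[K] K) :=
  (k.factorial : K)⁻¹ • ∑ J : Fin k → Fin 7, (∏ i, (metricSign s (J i) : K)) •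
    (LinearMap.mul K K).compl₁₂ (evalForm K (e ∘ J)) (evalForm K (e ∘ J))

theorem inducedForm_apply (s : ℤ) (e : Module.Basis (Fin 7) K V) {k : ℕ}
    (α β : V [⋀^Fin k]→ₗ[K] K) :
    inducedForm s e k α β = (k.factorial : K)⁻¹ *
      ∑ J : Fin k → Fin 7, (∏ i, (metricSign s (J i) : K)) * (α (e ∘ J) * β (e ∘ J)) := by
  simp [inducedForm, evalForm_apply]

theorem inducedForm_comm (s : ℤ) (e : Module.Basis (Fin 7) K V) {k : ℕ}
    (α β : V [⋀^Fin k]→ₗ[K] K) : inducedForm s e k α β = inducedForm s e k β α := by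
  simp [inducedForm_apply, mul_comm]

theorem apply_sharp (s : ℤ) (e : Module.Basis (Fin 7) K V) {k : ℕ}
    (α : Fin k → Module.Dual K V) (β : V [⋀^Fin k]→ₗ[K] K) :
    β (fun i => sharp s e (α i)) = ∑ J : Fin k → Fin 7,
      (∏ i, (metricSign s (J i) : K)) * ((∏ i, α i (e (J i))) * β (e ∘ J)) := by
  have h := β.toMultilinearMap.map_sum
    (fun i j => ((metricSign s j : K) * α i (e j)) • e j)
  refine (h.trans (Finset.sum_congr rfl fun J _ => ?_))
  rw [MultilinearMap.map_smul_univ, Finset.prod_mul_distrib, smul_eq_mul, mul_assoc]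
  rfl

/-- Expand the decomposable form over permutations. Reindexing `J` by `σ` produces the sign of `σ` a
second time, so all `k!` permutations contribute equally, which cancels the factor `1/k!`. -/
theorem inducedForm_wedgeCovectors [CharZero K] (s : ℤ) (e : Module.Basis (Fin 7) K V) {k : ℕ}
    (α : Fin k → Module.Dual K V) (β : V [⋀^Fin k]→ₗ[K] K) :
    inducedForm s e k (wedgeCovectors α) β = β (fun i => sharp s e (α i)) := by
  have h (σ : Equiv.Perm (Fin k)) : ∑ J : Fin k → Fin 7, (∏ i, (metricSign s (J i) : K)) *
      ((Equiv.Perm.sign σ • ∏ i, α i (e (J (σ i)))) * β (e ∘ J)) =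
        β (fun i => sharp s e (α i)) := by
    rw [apply_sharp]
    refine Fintype.sum_equiv (Equiv.arrowCongr σ.symm (Equiv.refl _)) _ _ fun J => ?_
    have h1 : (Equiv.arrowCongr σ.symm (Equiv.refl _)) J = J ∘ σ := by
      ext; simp
    rw [h1]
    have h2 : β (e ∘ J ∘ σ) = Equiv.Perm.sign σ • β (e ∘ J) := β.map_perm (e ∘ J) σ
    have h3 : ∏ i, (metricSign s ((J ∘ σ) i) : K) = ∏ i, (metricSign s (J i) : K) :=
      Equiv.prod_comp σ fun i => (metricSign s (J i) : K)
    rw [h2, h3]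
    simp only [Units.smul_def, zsmul_eq_mul, Function.comp_apply]
    ring
  rw [inducedForm_apply]
  simp_rw [wedgeCovectors_eq_sum, Function.comp_apply, Finset.sum_mul]
  simp only [Finset.mul_sum (Finset.univ : Finset (Equiv.Perm (Fin k)))]
  rw [Finset.sum_comm]
  have h4 : ∑ σ : Equiv.Perm (Fin k), ∑ J : Fin k → Fin 7, (∏ i, (metricSign s (J i) : K)) *
      ((Equiv.Perm.sign σ • ∏ i, α i (e (J (σ i)))) * β (e ∘ J)) =
      (k.factorial : K) * β (fun i => sharp s e (α i)) := by
    simp only [h, Finset.sum_const, Finset.card_univ, Fintype.card_perm, Fintype.card_fin,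
      nsmul_eq_mul]
  rw [h4, ← mul_assoc, inv_mul_cancel₀ (by exact_mod_cast k.factorial_ne_zero), one_mul]

theorem isInducedOnForms_inducedForm [CharZero K] {s : ℤ} (hs : s = 1 ∨ s = -1)
    (e : Module.Basis (Fin 7) K V) (k : ℕ) :
    IsInducedOnForms (metric s e) (inducedForm s e k) := by
  intro v w
  rw [inducedForm_wedgeCovectors]
  simp only [sharp_metric hs]
  rw [wedgeCovectors_apply]
  congr 1
  ext i j
  exact metric_comm s e _ _

theorem form_eq_sum_coordForm [CharZero K] (e : Module.Basis (Fin 7) K V) {k : ℕ}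
    (ψ : V [⋀^Fin k]→ₗ[K] K) :
    ψ = (k.factorial : K)⁻¹ • ∑ J : Fin k → Fin 7, ψ (e ∘ J) • coordForm e J := by
  ext v
  -- Evaluating `ψ` at `v` is pairing it with the decomposable form of the covectors dual to `v`;
  -- the definite sign `s = 1` makes all weights trivial.
  have h := inducedForm_wedgeCovectors 1 e (fun i => metric 1 e (v i)) ψ
  simp only [sharp_metric (Or.inl rfl)] at h
  rw [← h, inducedForm_apply]
  rw [← evalForm_apply, map_smul, map_sum, smul_eq_mul]
  congr 1
  refine Finset.sum_congr rfl fun J _ => ?_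
  have h1 (i : Fin 7) : metricSign 1 i = 1 := by simp [metricSign]
  have h2 : wedgeCovectors (fun i => metric 1 e (v i)) (e ∘ J) = coordForm e J v := by
    rw [wedgeCovectors_apply, coordForm, wedgeCovectors_apply, ← Matrix.det_transpose]
    congr 1
    ext i j
    simp [metric_comm 1 e (v i), metric_basis_left, h1]
  rw [h2, map_smul, evalForm_apply]
  simp [h1, mul_comm]

theorem exists_strictMono_comp_perm {k n : ℕ} {J : Fin k → Fin n} (hJ : Function.Injective J) :
    ∃ σ : Equiv.Perm (Fin k), StrictMono (J ∘ σ) :=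
  ⟨Tuple.sort J, (Tuple.monotone_sort J).strictMono_of_injective
    (hJ.comp (Tuple.sort J).injective)⟩

theorem coordForm_comp_perm {n k : ℕ} (e : Module.Basis (Fin n) K V) (J : Fin k → Fin n)
    (σ : Equiv.Perm (Fin k)) :
    coordForm e (J ∘ σ) = Equiv.Perm.sign σ • coordForm e J := by
  ext v
  rw [AlternatingMap.smul_apply, coordForm, coordForm, wedgeCovectors_apply, wedgeCovectors_apply]
  have := Matrix.det_permute' σ (Matrix.of fun i j => e.coord (J j) (v i))
  rw [Units.smul_def, zsmul_eq_mul, ← this]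
  rfl

theorem functional_ext [CharZero K] (e : Module.Basis (Fin 7) K V) {k : ℕ}
    {L M : (V [⋀^Fin k]→ₗ[K] K) →ₗ[K] K}
    (h : ∀ J : Fin k → Fin 7, StrictMono J → L (coordForm e J) = M (coordForm e J)) : L = M := by
  have key (J : Fin k → Fin 7) : L (coordForm e J) = M (coordForm e J) := by
    by_cases hJ : Function.Injective J
    · obtain ⟨σ, hσ⟩ := exists_strictMono_comp_perm hJ
      have h1 := h _ hσ
      rw [coordForm_comp_perm, Units.smul_def, map_zsmul, map_zsmul] at h1
      rcases Int.units_eq_one_or (Equiv.Perm.sign σ) with h2 | h2 <;> simpa [h2] using h1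
    · have h0 : coordForm e J = 0 := by
        obtain ⟨i, j, hij, hne⟩ : ∃ i j, J i = J j ∧ i ≠ j := by
          simpa [Function.Injective] using hJ
        ext v
        rw [coordForm, wedgeCovectors_apply]
        exact Matrix.det_zero_of_column_eq hne (by simp [hij])
      rw [h0, map_zero, map_zero]
  ext ψ
  rw [form_eq_sum_coordForm e ψ]
  simp only [map_smul, map_sum, key]

theorem alternatingMap_ext_strictMono {n k : ℕ} (e : Module.Basis (Fin n) K V)
    {α β : V [⋀^Fin k]→ₗ[K] K}
    (h : ∀ J : Fin k → Fin n, StrictMono J → α (e ∘ J) = β (e ∘ J)) : α = β := by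
  refine Module.Basis.ext_alternating e fun J hJ => ?_
  obtain ⟨σ, hσ⟩ := exists_strictMono_comp_perm hJ
  have h1 := h _ hσ
  rw [← Function.comp_assoc, α.map_perm, β.map_perm] at h1
  rcases Int.units_eq_one_or (Equiv.Perm.sign σ) with h2 | h2 <;> simpa [h2, Function.comp_def] using h1

theorem coordForm_eq_wedgeCovectors_metric {s : ℤ} (hs : s = 1 ∨ s = -1)
    (e : Module.Basis (Fin 7) K V) {k : ℕ} (J : Fin k → Fin 7) :
    coordForm e J = wedgeCovectors fun i => metric s e (sharp s e (e.coord (J i))) := by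
  simp only [metric_sharp hs]
  rfl

/-- Every covector has the form `g (v, ·)`, so the Gram determinants prescribe `G` on all pairs of
coordinate forms, and these span. -/
theorem IsInducedOnForms.eq_inducedForm [CharZero K] {s : ℤ} (hs : s = 1 ∨ s = -1)
    {e : Module.Basis (Fin 7) K V} {k : ℕ} {G : LinearMap.BilinForm K (V [⋀^Fin k]→ₗ[K] K)}
    (hG : IsInducedOnForms (metric s e) G) : G = inducedForm s e k := by
  refine LinearMap.ext fun α => functional_ext e fun J _ => ?_
  have h : G.flip (coordForm e J) = (inducedForm s e k).flip (coordForm e J) := by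
    refine functional_ext e fun I _ => ?_
    change G (coordForm e I) (coordForm e J) = inducedForm s e k (coordForm e I) (coordForm e J)
    rw [coordForm_eq_wedgeCovectors_metric hs e I,
      coordForm_eq_wedgeCovectors_metric hs e J, hG, isInducedOnForms_inducedForm hs]
  exact LinearMap.congr_fun h α

/-- It suffices to test against `e^J` for increasing `J`, and pairing `χ` with `e^J` reads off the
component `χ (e ∘ J)` up to a product of metric signs. This gives both existence and uniqueness of
the Hodge dual. -/
theorem isHodgeDual_iff [CharZero K] {s : ℤ} (hs : s = 1 ∨ s = -1)
    (e : Module.Basis (Fin 7) K V) (φ : V [⋀^Fin 3]→ₗ[K] K) (χ : V [⋀^Fin 4]→ₗ[K] K) :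
    IsHodgeDual (k := 3) (l := 4) (metric s e) (coordForm e id) φ χ ↔
      ∀ J : Fin 4 → Fin 7, StrictMono J →
        wedge₃₄ φ (coordForm e J) e = (∏ i, (metricSign s (J i) : K)) * χ (e ∘ J) := by
  have key (J : Fin 4 → Fin 7) : inducedForm s e 4 χ (coordForm e J) =
      (∏ i, (metricSign s (J i) : K)) * χ (e ∘ J) := by
    rw [inducedForm_comm, coordForm, inducedForm_wedgeCovectors]
    simp only [sharp_coord]
    exact χ.toMultilinearMap.map_smul_univ (fun i => (metricSign s (J i) : K)) (e ∘ J)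
  have hdef : IsHodgeDual (k := 3) (l := 4) (metric s e) (coordForm e id) φ χ ↔
      ∃ G : LinearMap.BilinForm K (V [⋀^Fin 4]→ₗ[K] K), IsInducedOnForms (metric s e) G ∧
        ∀ ψ, wedge₃₄ φ ψ = G χ ψ • coordForm e id :=
    ⟨fun ⟨G, hG, h⟩ => ⟨G, hG, fun ψ => (h ψ).trans (congrArg₂ HSMul.hSMul rfl rfl)⟩,
      fun ⟨G, hG, h⟩ => ⟨G, hG, fun ψ => (h ψ).trans (congrArg₂ HSMul.hSMul rfl rfl)⟩⟩
  rw [hdef]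
  constructor
  · rintro ⟨G, hG, h⟩ J _
    rw [← key, ← hG.eq_inducedForm hs, h, AlternatingMap.smul_apply, coordForm_id_self,
      smul_eq_mul, mul_one]
  · intro h
    refine ⟨inducedForm s e 4, isInducedOnForms_inducedForm hs e 4, fun ψ => topForm_ext e ?_⟩
    rw [AlternatingMap.smul_apply, coordForm_id_self, smul_eq_mul, mul_one]
    have h1 : evalForm K e ∘ₗ wedge₃₄Linear φ = inducedForm s e 4 χ :=
      functional_ext e fun J hJ => by rw [key, ← h J hJ, LinearMap.comp_apply, evalForm_apply,
        wedge₃₄Linear_apply]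
    rw [← h1, LinearMap.comp_apply, evalForm_apply, wedge₃₄Linear_apply]

end Forms

section Forms
variable {K V : Type*} [Field K] [AddCommGroup V] [Module K V]

/-! ### The Hodge dual of the standard three-forms -/

/-- The terms of the Hodge dual of `phi s e`. -/
def psiTerms (s : ℤ) : List (ℤ × (Fin 4 → Fin 7)) :=
  [(1, ![0, 1, 2, 3]), (s, ![0, 1, 4, 5]), (1, ![0, 2, 5, 6]), (1, ![0, 3, 4, 6]),
    (1, ![1, 2, 4, 6]), (-1, ![1, 3, 5, 6]), (s, ![2, 3, 4, 5])]

/-- The Hodge dual of `phi s e`. -/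
def psi (s : ℤ) (e : Module.Basis (Fin 7) K V) : V [⋀^Fin 4]→ₗ[K] K :=
  formOfList e (psiTerms s)

/-- The terms of the one-form `w ↦ psi s e (w, e a, e b, e c)`. -/
def psiSlot (s : ℤ) (a b c : Fin 7) : List (ℤ × Fin 7) :=
  (contractTerms c (contractTerms b (contractTerms a (psiTerms s)))).map fun p => (-p.1, p.2 0)

theorem formOfList_one_apply (e : Module.Basis (Fin 7) K V) (L : List (ℤ × (Fin 1 → Fin 7)))
    (w : V) : formOfList e L ![w] = (L.map fun p => (p.1 : K) * e.coord (p.2 0) w).sum := by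
  induction L with
  | nil => rfl
  | cons p L ih =>
    simp [formOfList_cons, ih, coordForm, wedgeCovectors_apply]

theorem psi_apply (s : ℤ) (e : Module.Basis (Fin 7) K V) (a b c : Fin 7) (w : V) :
    psi s e ![w, e a, e b, e c] =
      ((psiSlot s a b c).map fun p => (p.1 : K) * e.coord p.2 w).sum := by
  have h1 : psi s e ![e a, e b, e c, w] = ((contractTerms c (contractTerms b
      (contractTerms a (psiTerms s)))).map fun p => (p.1 : K) * e.coord (p.2 0) w).sum := by
    rw [← formOfList_one_apply, ← curryLeft_formOfList, ← curryLeft_formOfList,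
      ← curryLeft_formOfList]
    rfl
  -- Moving `w` from the last slot to the first is a four-cycle, hence odd; this is the sign built
  -- into `psiSlot`.
  have h2 : psi s e ![w, e a, e b, e c] = -psi s e ![e a, e b, e c, w] := by
    have h := (psi s e).map_perm ![w, e a, e b, e c] (finRotate 4)
    have h3 : ![w, e a, e b, e c] ∘ finRotate 4 = ![e a, e b, e c, w] := by
      ext i; fin_cases i <;> rfl
    have h4 : Equiv.Perm.sign (finRotate 4) = -1 := by simp [sign_finRotate]; decide
    rw [h3, h4] at h
    rw [h]
    simp
  rw [h2, h1, psiSlot]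
  generalize contractTerms c (contractTerms b (contractTerms a (psiTerms s))) = L
  induction L with
  | nil => simp
  | cons p L ih =>
    simp only [List.map_cons, List.sum_cons, ← ih]
    push_cast
    ring

theorem psiSlot_table {s : ℤ} (hs : s = 1 ∨ s = -1) :
    psiSlot s 0 1 2 = [(-1, 3)] ∧ psiSlot s 0 1 3 = [(1, 2)] ∧ psiSlot s 0 1 4 = [(-s, 5)] ∧
    psiSlot s 0 1 5 = [(s, 4)] ∧ psiSlot s 0 1 6 = [] ∧ psiSlot s 0 2 3 = [(-1, 1)] ∧
    psiSlot s 0 2 4 = [] ∧ psiSlot s 0 2 5 = [(-1, 6)] ∧ psiSlot s 0 2 6 = [(1, 5)] ∧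
    psiSlot s 0 3 4 = [(-1, 6)] ∧ psiSlot s 0 3 5 = [] ∧ psiSlot s 0 3 6 = [(1, 4)] ∧
    psiSlot s 0 4 5 = [(-s, 1)] ∧ psiSlot s 0 4 6 = [(-1, 3)] ∧ psiSlot s 0 5 6 = [(-1, 2)] ∧
    psiSlot s 1 2 3 = [(1, 0)] ∧ psiSlot s 1 2 4 = [(-1, 6)] ∧ psiSlot s 1 2 5 = [] ∧
    psiSlot s 1 2 6 = [(1, 4)] ∧ psiSlot s 1 3 4 = [] ∧ psiSlot s 1 3 5 = [(1, 6)] ∧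
    psiSlot s 1 3 6 = [(-1, 5)] ∧ psiSlot s 1 4 5 = [(s, 0)] ∧ psiSlot s 1 4 6 = [(-1, 2)] ∧
    psiSlot s 1 5 6 = [(1, 3)] ∧ psiSlot s 2 3 4 = [(-s, 5)] ∧ psiSlot s 2 3 5 = [(s, 4)] ∧
    psiSlot s 2 3 6 = [] ∧ psiSlot s 2 4 5 = [(-s, 3)] ∧ psiSlot s 2 4 6 = [(1, 1)] ∧
    psiSlot s 2 5 6 = [(1, 0)] ∧ psiSlot s 3 4 5 = [(s, 2)] ∧ psiSlot s 3 4 6 = [(1, 0)] ∧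
    psiSlot s 3 5 6 = [(-1, 1)] ∧ psiSlot s 4 5 6 = [] := by
  rcases hs with rfl | rfl <;> and_intros <;> decide

/-- The terms of the wedge product of a three-form and a four-form in dimension seven. -/
def wedgeTerms₃₄ (L : List (ℤ × (Fin 3 → Fin 7))) (M : List (ℤ × (Fin 4 → Fin 7))) :
    List (ℤ × (Fin 7 → Fin 7)) :=
  wedgeTerms L M

theorem wedge₃₄_formOfList (e : Module.Basis (Fin 7) K V) (L : List (ℤ × (Fin 3 → Fin 7)))
    (M : List (ℤ × (Fin 4 → Fin 7))) :
    wedge₃₄ (formOfList e L) (formOfList e M) = formOfList e (wedgeTerms₃₄ L M) :=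
  wedge_formOfList e L M

/-- A finite check over the 35 increasing quadruples; the last factor is the component of `psi s` on
`a, b, c, d`. -/
theorem phiTerms_hodge {s : ℤ} (hs : s = 1 ∨ s = -1) :
    ∀ a b : Fin 7, a < b → ∀ c, b < c → ∀ d, c < d →
      ((wedgeTerms₃₄ (phiTerms s) [(1, ![a, b, c, d])]).map fun p => p.1 * tupleSign p.2).sum =
        (metricSign s a * metricSign s b * metricSign s c * metricSign s d) *
          ((psiSlot s b c d).map fun p => p.1 * if a = p.2 then 1 else 0).sum := by
  simp only [tupleSign_eq_listSign]
  rcases hs with rfl | rfl <;> decide +kernel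

theorem isHodgeDual_psi [CharZero K] {s : ℤ} (hs : s = 1 ∨ s = -1)
    (e : Module.Basis (Fin 7) K V) :
    IsHodgeDual (k := 3) (l := 4) (metric s e) (coordForm e id) (phi s e) (psi s e) := by
  rw [isHodgeDual_iff hs]
  intro J hJ
  have h := phiTerms_hodge hs (J 0) (J 1) (hJ (by decide)) (J 2) (hJ (by decide)) (J 3)
    (hJ (by decide))
  have hJ' : ![J 0, J 1, J 2, J 3] = J := by ext i; fin_cases i <;> rfl
  have he : e ∘ J = ![e (J 0), e (J 1), e (J 2), e (J 3)] := by ext i; fin_cases i <;> rfl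
  have h1 : coordForm e J = formOfList e [(1, ![J 0, J 1, J 2, J 3])] := by
    rw [formOfList_cons, formOfList_nil, hJ', Int.cast_one, one_smul, add_zero]
  rw [h1, phi, wedge₃₄_formOfList, formOfList_apply_basis]
  rw [h, he, psi_apply, Fin.prod_univ_four]
  push_cast
  congr 1
  rw [List.map_map]
  congr 2
  ext p
  simp [Finsupp.single_apply]

theorem IsHodgeDual.eq_psi [CharZero K] {s : ℤ} (hs : s = 1 ∨ s = -1)
    {e : Module.Basis (Fin 7) K V} {χ : V [⋀^Fin 4]→ₗ[K] K}
    (h : IsHodgeDual (k := 3) (l := 4) (metric s e) (coordForm e id) (phi s e) χ) :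
    χ = psi s e := by
  refine alternatingMap_ext_strictMono e fun J hJ => ?_
  have h1 := (isHodgeDual_iff hs e _ _).1 h J hJ
  rw [(isHodgeDual_iff hs e _ _).1 (isHodgeDual_psi hs e) J hJ] at h1
  refine (mul_left_cancel₀ ?_ h1).symm
  refine Finset.prod_ne_zero_iff.2 fun i _ => ?_
  have h2 := metricSign_mul_self hs (J i)
  intro h0
  rw [Int.cast_eq_zero] at h0
  rw [h0] at h2
  simp at h2

end Forms

/-! ### The exterior derivative on Lie algebras with a codimension one Abelian ideal -/

section Bivectors
variable {K V : Type*} [Field K] [AddCommGroup V] [Module K V]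

/-- The bivector `u ∧ v`, as an alternating bilinear form on covectors. -/
def bivec (u v : V) : LinearMap.BilinForm K (Module.Dual K V) :=
  LinearMap.mk₂ K (fun α β => α u * β v - α v * β u)
    (fun _ _ _ => by simp; ring) (fun _ _ _ => by simp; ring)
    (fun _ _ _ => by simp; ring) (fun _ _ _ => by simp; ring)

theorem bivec_apply (u v : V) (α β : Module.Dual K V) :
    bivec u v α β = α u * β v - α v * β u := rfl

/-- The bivector obtained from the two-form `ξ^♯ ⌟ phi s e` by raising indices. -/
def phiBivec (s : ℤ) (e : Module.Basis (Fin 7) K V) (ξ : Module.Dual K V) :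
    LinearMap.BilinForm K (Module.Dual K V) :=
  -- Raising indices does not change the coefficients: each monomial contains none or two of the
  -- first four indices, where the metric sign is `s`.
  ((phiTerms s).map fun p => (p.1 : K) • (ξ (e (p.2 0)) • bivec (e (p.2 1)) (e (p.2 2)) +
    ξ (e (p.2 1)) • bivec (e (p.2 2)) (e (p.2 0)) +
    ξ (e (p.2 2)) • bivec (e (p.2 0)) (e (p.2 1)))).sum

/-- The bivector `B` on the kernel of `ξ` is an eigenvector of `A` for the eigenvalue `tr A`. -/
structure IsTraceBivector (A : V →ₗ[K] V) (ξ : Module.Dual K V)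
    (B : LinearMap.BilinForm K (Module.Dual K V)) : Prop where
  alt : ∀ α, B α α = 0
  left : ∀ β, B ξ β = 0
  trace : ∀ α β, B (α ∘ₗ A) β + B α (β ∘ₗ A) = LinearMap.trace K V A * B α β

end Bivectors

section LieAlgebra
variable {K 𝔤 : Type*} [Field K] [LieRing 𝔤] [LieAlgebra K 𝔤]

theorem removeNth_removeNth_five {X : Type*} (v : Fin 5 → X) :
    ((0 : Fin 4).removeNth ((1 : Fin 5).removeNth v) = ![v 2, v 3, v 4] ∧
    (0 : Fin 4).removeNth ((2 : Fin 5).removeNth v) = ![v 1, v 3, v 4] ∧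
    (0 : Fin 4).removeNth ((3 : Fin 5).removeNth v) = ![v 1, v 2, v 4] ∧
    (0 : Fin 4).removeNth ((4 : Fin 5).removeNth v) = ![v 1, v 2, v 3] ∧
    (1 : Fin 4).removeNth ((2 : Fin 5).removeNth v) = ![v 0, v 3, v 4] ∧
    (1 : Fin 4).removeNth ((3 : Fin 5).removeNth v) = ![v 0, v 2, v 4] ∧
    (1 : Fin 4).removeNth ((4 : Fin 5).removeNth v) = ![v 0, v 2, v 3] ∧
    (2 : Fin 4).removeNth ((3 : Fin 5).removeNth v) = ![v 0, v 1, v 4] ∧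
    (2 : Fin 4).removeNth ((4 : Fin 5).removeNth v) = ![v 0, v 1, v 3] ∧
    (3 : Fin 4).removeNth ((4 : Fin 5).removeNth v) = ![v 0, v 1, v 2]) ∧
    ((0 : Fin 4).removeNth ((0 : Fin 5).removeNth v) = ![v 2, v 3, v 4] ∧
    (1 : Fin 4).removeNth ((0 : Fin 5).removeNth v) = ![v 1, v 3, v 4] ∧
    (2 : Fin 4).removeNth ((0 : Fin 5).removeNth v) = ![v 1, v 2, v 4] ∧
    (3 : Fin 4).removeNth ((0 : Fin 5).removeNth v) = ![v 1, v 2, v 3] ∧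
    (1 : Fin 4).removeNth ((1 : Fin 5).removeNth v) = ![v 0, v 3, v 4] ∧
    (2 : Fin 4).removeNth ((1 : Fin 5).removeNth v) = ![v 0, v 2, v 4] ∧
    (3 : Fin 4).removeNth ((1 : Fin 5).removeNth v) = ![v 0, v 2, v 3] ∧
    (2 : Fin 4).removeNth ((2 : Fin 5).removeNth v) = ![v 0, v 1, v 4] ∧
    (3 : Fin 4).removeNth ((2 : Fin 5).removeNth v) = ![v 0, v 1, v 3] ∧
    (3 : Fin 4).removeNth ((3 : Fin 5).removeNth v) = ![v 0, v 1, v 2]) := by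
  refine ⟨⟨?_, ?_, ?_, ?_, ?_, ?_, ?_, ?_, ?_, ?_⟩, ⟨?_, ?_, ?_, ?_, ?_, ?_, ?_, ?_, ?_, ?_⟩⟩ <;>
    (ext i; fin_cases i <;> rfl)

theorem lieExtDeriv_four_apply (Ψ : 𝔤 [⋀^Fin 4]→ₗ[K] K) (v : Fin 5 → 𝔤) :
    lieExtDeriv Ψ v = -Ψ ![⁅v 0, v 1⁆, v 2, v 3, v 4] + Ψ ![⁅v 0, v 2⁆, v 1, v 3, v 4]
      - Ψ ![⁅v 0, v 3⁆, v 1, v 2, v 4] + Ψ ![⁅v 0, v 4⁆, v 1, v 2, v 3]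
      - Ψ ![⁅v 1, v 2⁆, v 0, v 3, v 4] + Ψ ![⁅v 1, v 3⁆, v 0, v 2, v 4]
      - Ψ ![⁅v 1, v 4⁆, v 0, v 2, v 3] - Ψ ![⁅v 2, v 3⁆, v 0, v 1, v 4]
      + Ψ ![⁅v 2, v 4⁆, v 0, v 1, v 3] - Ψ ![⁅v 3, v 4⁆, v 0, v 1, v 2] := by
  obtain ⟨⟨h1, h2, h3, h4, h5, h6, h7, h8, h9, h10⟩, -⟩ := removeNth_removeNth_five v
  have hc (x : 𝔤) (w : Fin 3 → 𝔤) : (Fin.cons x w : Fin 4 → 𝔤) = Matrix.vecCons x w := rfl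
  change (∑ j : Fin 5, ∑ i : Fin 4, if i.castSucc < j then (-1) ^ ((i : ℕ) + (j : ℕ)) *
    Ψ (Fin.cons ⁅v i.castSucc, v j⁆ (i.removeNth (j.removeNth v))) else 0) = _
  simp only [Fin.sum_univ_five, Fin.sum_univ_four]
  simp only [show (0 : Fin 4).castSucc = 0 from rfl, show (1 : Fin 4).castSucc = 1 from rfl,
    show (2 : Fin 4).castSucc = 2 from rfl, show (3 : Fin 4).castSucc = 3 from rfl,
    h1, h2, h3, h4, h5, h6, h7, h8, h9, h10, hc]
  simp
  ring

/-- The five-form `ξ ∧ (A · Ψ)`, where `A` acts as a derivation. -/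
def derivWedge (ξ : Module.Dual K 𝔤) (A : 𝔤 →ₗ[K] 𝔤) (Ψ : 𝔤 [⋀^Fin 4]→ₗ[K] K) :
    𝔤 [⋀^Fin 5]→ₗ[K] K :=
  AlternatingMap.alternatizeUncurryFin
    (ξ.smulRight (AlternatingMap.alternatizeUncurryFin (Ψ.curryLeft ∘ₗ A)))

/-- `lieExtDeriv` is a bare function of its arguments. Writing it through an alternating map allows
its vanishing to be tested on increasing basis tuples only. -/
theorem lieExtDeriv_eq_neg_derivWedge {ξ : Module.Dual K 𝔤} {A : 𝔤 →ₗ[K] 𝔤}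
    (hbr : ∀ v w : 𝔤, ⁅v, w⁆ = ξ v • A w - ξ w • A v) (Ψ : 𝔤 [⋀^Fin 4]→ₗ[K] K)
    (v : Fin 5 → 𝔤) : lieExtDeriv Ψ v = -derivWedge ξ A Ψ v := by
  have hΨ (a b x y z : 𝔤) : Ψ ![⁅a, b⁆, x, y, z] =
      ξ a * Ψ ![A b, x, y, z] - ξ b * Ψ ![A a, x, y, z] := by
    have h := map_sub Ψ.curryLeft (ξ a • A b) (ξ b • A a)
    rw [map_smul, map_smul, ← hbr] at h
    exact congrArg (fun F => F ![x, y, z]) h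
  obtain ⟨⟨h1, h2, h3, h4, h5, h6, h7, h8, h9, h10⟩, ⟨g1, g2, g3, g4, g5, g6, g7, g8, g9, g10⟩⟩ :=
    removeNth_removeNth_five v
  have hD : derivWedge ξ A Ψ v = ∑ i : Fin 5, (-1) ^ (i : ℕ) * (ξ (v i) * ∑ k : Fin 4,
      (-1) ^ (k : ℕ) * Ψ (Matrix.vecCons (A (i.removeNth v k)) (k.removeNth (i.removeNth v)))) := by
    rw [derivWedge, AlternatingMap.alternatizeUncurryFin_apply]
    refine Finset.sum_congr rfl fun i _ => ?_
    rw [LinearMap.smulRight_apply, AlternatingMap.smul_apply,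
      AlternatingMap.alternatizeUncurryFin_apply]
    simp only [zsmul_eq_mul, smul_eq_mul]
    push_cast
    rfl
  rw [lieExtDeriv_four_apply, hD]
  simp only [Fin.sum_univ_five, Fin.sum_univ_four,
    h1, h2, h3, h4, h5, h6, h7, h8, h9, h10, g1, g2, g3, g4, g5, g6, g7, g8, g9, g10, hΨ]
  simp only [Fin.removeNth_apply, show (0 : Fin 5).succAbove (0 : Fin 4) = 1 from rfl,
    show (0 : Fin 5).succAbove (1 : Fin 4) = 2 from rfl,
    show (0 : Fin 5).succAbove (2 : Fin 4) = 3 from rfl,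
    show (0 : Fin 5).succAbove (3 : Fin 4) = 4 from rfl,
    show (1 : Fin 5).succAbove (0 : Fin 4) = 0 from rfl,
    show (1 : Fin 5).succAbove (1 : Fin 4) = 2 from rfl,
    show (1 : Fin 5).succAbove (2 : Fin 4) = 3 from rfl,
    show (1 : Fin 5).succAbove (3 : Fin 4) = 4 from rfl,
    show (2 : Fin 5).succAbove (0 : Fin 4) = 0 from rfl,
    show (2 : Fin 5).succAbove (1 : Fin 4) = 1 from rfl,
    show (2 : Fin 5).succAbove (2 : Fin 4) = 3 from rfl,
    show (2 : Fin 5).succAbove (3 : Fin 4) = 4 from rfl,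
    show (3 : Fin 5).succAbove (0 : Fin 4) = 0 from rfl,
    show (3 : Fin 5).succAbove (1 : Fin 4) = 1 from rfl,
    show (3 : Fin 5).succAbove (2 : Fin 4) = 2 from rfl,
    show (3 : Fin 5).succAbove (3 : Fin 4) = 4 from rfl,
    show (4 : Fin 5).succAbove (0 : Fin 4) = 0 from rfl,
    show (4 : Fin 5).succAbove (1 : Fin 4) = 1 from rfl,
    show (4 : Fin 5).succAbove (2 : Fin 4) = 2 from rfl,
    show (4 : Fin 5).succAbove (3 : Fin 4) = 3 from rfl]
  simp
  ring

end LieAlgebra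

section LieAlgebra
variable {K 𝔤 : Type*} [Field K] [LieRing 𝔤] [LieAlgebra K 𝔤]

/-- The defect of the trace bivector equation. -/
def traceDefect {V : Type*} [AddCommGroup V] [Module K V] (A : V →ₗ[K] V)
    (B : LinearMap.BilinForm K (Module.Dual K V)) (α β : Module.Dual K V) : K :=
  B (α ∘ₗ A) β + B α (β ∘ₗ A) - LinearMap.trace K V A * B α β

theorem phiBivec_apply {V : Type*} [AddCommGroup V] [Module K V] (s : ℤ)
    (e : Module.Basis (Fin 7) K V) (ξ α β : Module.Dual K V) :
    phiBivec s e ξ α β =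
      s * (ξ (e 0) * bivec (e 1) (e 6) α β + ξ (e 1) * bivec (e 6) (e 0) α β
        + ξ (e 6) * bivec (e 0) (e 1) α β)
      + s * (ξ (e 2) * bivec (e 3) (e 6) α β + ξ (e 3) * bivec (e 6) (e 2) α β
        + ξ (e 6) * bivec (e 2) (e 3) α β)
      + (ξ (e 4) * bivec (e 5) (e 6) α β + ξ (e 5) * bivec (e 6) (e 4) α β
        + ξ (e 6) * bivec (e 4) (e 5) α β)
      + (ξ (e 0) * bivec (e 2) (e 4) α β + ξ (e 2) * bivec (e 4) (e 0) α β
        + ξ (e 4) * bivec (e 0) (e 2) α β)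
      - (ξ (e 0) * bivec (e 3) (e 5) α β + ξ (e 3) * bivec (e 5) (e 0) α β
        + ξ (e 5) * bivec (e 0) (e 3) α β)
      - (ξ (e 1) * bivec (e 2) (e 5) α β + ξ (e 2) * bivec (e 5) (e 1) α β
        + ξ (e 5) * bivec (e 1) (e 2) α β)
      - (ξ (e 1) * bivec (e 3) (e 4) α β + ξ (e 3) * bivec (e 4) (e 1) α β
        + ξ (e 4) * bivec (e 1) (e 3) α β) := by
  simp [phiBivec, phiTerms]
  ring

theorem trace_eq_sum_coord {V : Type*} [AddCommGroup V] [Module K V]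
    (e : Module.Basis (Fin 7) K V) (A : V →ₗ[K] V) :
    LinearMap.trace K V A = ∑ i, e.coord i (A (e i)) := by
  rw [LinearMap.trace_eq_matrix_trace K e]
  simp [Matrix.trace, LinearMap.toMatrix_apply]

theorem coord_basis {V : Type*} [AddCommGroup V] [Module K V]
    (e : Module.Basis (Fin 7) K V) (i j : Fin 7) :
    e.coord i (e j) = if i = j then 1 else 0 := by
  simp [Finsupp.single_apply, eq_comm]

theorem phiBivec_coord_right {V : Type*} [AddCommGroup V] [Module K V] (s : ℤ)
    (e : Module.Basis (Fin 7) K V) (ξ α : Module.Dual K V) :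
    phiBivec s e ξ α (e.coord 0) = s * (ξ (e 1) * α (e 6) - ξ (e 6) * α (e 1))
      + (ξ (e 2) * α (e 4) - ξ (e 4) * α (e 2)) - (ξ (e 3) * α (e 5) - ξ (e 5) * α (e 3)) ∧
    phiBivec s e ξ α (e.coord 1) = s * (ξ (e 6) * α (e 0) - ξ (e 0) * α (e 6))
      - (ξ (e 2) * α (e 5) - ξ (e 5) * α (e 2)) - (ξ (e 3) * α (e 4) - ξ (e 4) * α (e 3)) ∧
    phiBivec s e ξ α (e.coord 2) = s * (ξ (e 3) * α (e 6) - ξ (e 6) * α (e 3))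
      + (ξ (e 4) * α (e 0) - ξ (e 0) * α (e 4)) + (ξ (e 1) * α (e 5) - ξ (e 5) * α (e 1)) ∧
    phiBivec s e ξ α (e.coord 3) = s * (ξ (e 6) * α (e 2) - ξ (e 2) * α (e 6))
      + (ξ (e 0) * α (e 5) - ξ (e 5) * α (e 0)) + (ξ (e 1) * α (e 4) - ξ (e 4) * α (e 1)) ∧
    phiBivec s e ξ α (e.coord 4) = (ξ (e 5) * α (e 6) - ξ (e 6) * α (e 5))
      + (ξ (e 0) * α (e 2) - ξ (e 2) * α (e 0)) - (ξ (e 1) * α (e 3) - ξ (e 3) * α (e 1)) ∧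
    phiBivec s e ξ α (e.coord 5) = (ξ (e 6) * α (e 4) - ξ (e 4) * α (e 6))
      - (ξ (e 0) * α (e 3) - ξ (e 3) * α (e 0)) - (ξ (e 1) * α (e 2) - ξ (e 2) * α (e 1)) ∧
    phiBivec s e ξ α (e.coord 6) = s * (ξ (e 0) * α (e 1) - ξ (e 1) * α (e 0))
      + s * (ξ (e 2) * α (e 3) - ξ (e 3) * α (e 2)) + (ξ (e 4) * α (e 5) - ξ (e 5) * α (e 4)) := by
  simp only [phiBivec_apply, bivec_apply, coord_basis]
  simp only [Fin.reduceEq, if_true, if_false]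
  and_intros <;> ring

theorem phiBivec_comm {V : Type*} [AddCommGroup V] [Module K V] (s : ℤ)
    (e : Module.Basis (Fin 7) K V) (ξ α β : Module.Dual K V) :
    phiBivec s e ξ α β = -phiBivec s e ξ β α := by
  simp only [phiBivec_apply, bivec_apply]
  ring

set_option linter.unusedSimpArgs false in
set_option maxHeartbeats 2000000 in
-- The isomorphism Λ⁴𝔲* ≅ Λ²𝔲 ⊗ Λ⁶𝔲* in coordinates: a component of the derivative on five basis
-- vectors is the defect of the bivector equation on the two complementary covectors, with the sign
-- of the permutation that splits the seven indices in this way.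
theorem lieExtDeriv_psi_basis {s : ℤ} (hs : s = 1 ∨ s = -1) {ξ : Module.Dual K 𝔤}
    {A : 𝔤 →ₗ[K] 𝔤} (hbr : ∀ v w : 𝔤, ⁅v, w⁆ = ξ v • A w - ξ w • A v)
    (hA : ∀ v, ξ (A v) = 0) (e : Module.Basis (Fin 7) K 𝔤) :
    lieExtDeriv (psi s e) (e ∘ ![0, 1, 2, 3, 4]) =
      traceDefect A (phiBivec s e ξ) (e.coord 5) (e.coord 6) ∧
    lieExtDeriv (psi s e) (e ∘ ![0, 1, 2, 3, 5]) =
      -traceDefect A (phiBivec s e ξ) (e.coord 4) (e.coord 6) ∧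
    lieExtDeriv (psi s e) (e ∘ ![0, 1, 2, 3, 6]) =
      traceDefect A (phiBivec s e ξ) (e.coord 4) (e.coord 5) ∧
    lieExtDeriv (psi s e) (e ∘ ![0, 1, 2, 4, 5]) =
      traceDefect A (phiBivec s e ξ) (e.coord 3) (e.coord 6) ∧
    lieExtDeriv (psi s e) (e ∘ ![0, 1, 2, 4, 6]) =
      -traceDefect A (phiBivec s e ξ) (e.coord 3) (e.coord 5) ∧
    lieExtDeriv (psi s e) (e ∘ ![0, 1, 2, 5, 6]) =
      traceDefect A (phiBivec s e ξ) (e.coord 3) (e.coord 4) ∧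
    lieExtDeriv (psi s e) (e ∘ ![0, 1, 3, 4, 5]) =
      -traceDefect A (phiBivec s e ξ) (e.coord 2) (e.coord 6) ∧
    lieExtDeriv (psi s e) (e ∘ ![0, 1, 3, 4, 6]) =
      traceDefect A (phiBivec s e ξ) (e.coord 2) (e.coord 5) ∧
    lieExtDeriv (psi s e) (e ∘ ![0, 1, 3, 5, 6]) =
      -traceDefect A (phiBivec s e ξ) (e.coord 2) (e.coord 4) ∧
    lieExtDeriv (psi s e) (e ∘ ![0, 1, 4, 5, 6]) =
      traceDefect A (phiBivec s e ξ) (e.coord 2) (e.coord 3) ∧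
    lieExtDeriv (psi s e) (e ∘ ![0, 2, 3, 4, 5]) =
      traceDefect A (phiBivec s e ξ) (e.coord 1) (e.coord 6) ∧
    lieExtDeriv (psi s e) (e ∘ ![0, 2, 3, 4, 6]) =
      -traceDefect A (phiBivec s e ξ) (e.coord 1) (e.coord 5) ∧
    lieExtDeriv (psi s e) (e ∘ ![0, 2, 3, 5, 6]) =
      traceDefect A (phiBivec s e ξ) (e.coord 1) (e.coord 4) ∧
    lieExtDeriv (psi s e) (e ∘ ![0, 2, 4, 5, 6]) =
      -traceDefect A (phiBivec s e ξ) (e.coord 1) (e.coord 3) ∧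
    lieExtDeriv (psi s e) (e ∘ ![0, 3, 4, 5, 6]) =
      traceDefect A (phiBivec s e ξ) (e.coord 1) (e.coord 2) ∧
    lieExtDeriv (psi s e) (e ∘ ![1, 2, 3, 4, 5]) =
      -traceDefect A (phiBivec s e ξ) (e.coord 0) (e.coord 6) ∧
    lieExtDeriv (psi s e) (e ∘ ![1, 2, 3, 4, 6]) =
      traceDefect A (phiBivec s e ξ) (e.coord 0) (e.coord 5) ∧
    lieExtDeriv (psi s e) (e ∘ ![1, 2, 3, 5, 6]) =
      -traceDefect A (phiBivec s e ξ) (e.coord 0) (e.coord 4) ∧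
    lieExtDeriv (psi s e) (e ∘ ![1, 2, 4, 5, 6]) =
      traceDefect A (phiBivec s e ξ) (e.coord 0) (e.coord 3) ∧
    lieExtDeriv (psi s e) (e ∘ ![1, 3, 4, 5, 6]) =
      -traceDefect A (phiBivec s e ξ) (e.coord 0) (e.coord 2) ∧
    lieExtDeriv (psi s e) (e ∘ ![2, 3, 4, 5, 6]) =
      traceDefect A (phiBivec s e ξ) (e.coord 0) (e.coord 1) := by
  have hx (i : Fin 7) : ∑ m, ξ (e m) * e.coord m (A (e i)) = 0 := by
    rw [← hA (e i)]
    conv_rhs => rw [← e.sum_repr (A (e i)), map_sum]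
    simp [mul_comm]
  simp only [Fin.sum_univ_seven] at hx
  have h0 := hx 0
  have h1 := hx 1
  have h2 := hx 2
  have h3 := hx 3
  have h4 := hx 4
  have h5 := hx 5
  have h6 := hx 6
  have hB (α β : Module.Dual K 𝔤) : traceDefect A (phiBivec s e ξ) α β =
      phiBivec s e ξ (α ∘ₗ A) β - phiBivec s e ξ (β ∘ₗ A) α -
        (∑ i, e.coord i (A (e i))) * phiBivec s e ξ α β := by
    rw [traceDefect, trace_eq_sum_coord e, phiBivec_comm s e ξ α (β ∘ₗ A)]
    ring
  have hc (α : Module.Dual K 𝔤) := phiBivec_coord_right s e ξ α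
  obtain ⟨t1, t2, t3, t4, t5, t6, t7, t8, t9, t10, t11, t12, t13, t14, t15, t16, t17, t18, t19,
    t20, t21, t22, t23, t24, t25, t26, t27, t28, t29, t30, t31, t32, t33, t34, t35⟩ :=
    psiSlot_table hs
  and_intros
  all_goals
    rw [lieExtDeriv_four_apply, hB]
    simp only [hc, hbr, Function.comp_apply, Matrix.cons_val, psi_apply,
      t1, t2, t3, t4, t5, t6, t7, t8, t9, t10, t11, t12, t13, t14, t15, t16, t17, t18, t19,
      t20, t21, t22, t23, t24, t25, t26, t27, t28, t29, t30, t31, t32, t33, t34, t35,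
      List.map_cons, List.map_nil, List.sum_cons, List.sum_nil, map_sub, map_smul, smul_eq_mul]
    simp only [coord_basis, LinearMap.comp_apply, Fin.sum_univ_seven]
    simp only [Fin.reduceEq, if_true, if_false]
    push_cast
  -- The two sides differ by a multiple of `ξ (A (e m)) = 0`, where `m` completes the complementary
  -- pair of indices to a monomial of `phi s e`; the factor is, up to sign, the coefficient of that
  -- monomial.
  · linear_combination h4
  · linear_combination h5
  · linear_combination h6
  · linear_combination (s : K) * h2
  · linear_combination h0
  · linear_combination -h1
  · linear_combination (s : K) * h3
  · linear_combination -h1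
  · linear_combination -h0
  · linear_combination (s : K) * h6
  · linear_combination (s : K) * h0
  · linear_combination -h2
  · linear_combination h3
  · linear_combination h4
  · linear_combination -h5
  · linear_combination (s : K) * h1
  · linear_combination h3
  · linear_combination h2
  · linear_combination -h5
  · linear_combination -h4
  · linear_combination (s : K) * h6

end LieAlgebra

section LieAlgebra
variable {K 𝔤 : Type*} [Field K] [LieRing 𝔤] [LieAlgebra K 𝔤]

theorem strictMono_five_seven : ∀ a b : Fin 7, a < b → ∀ c, b < c → ∀ d, c < d → ∀ f, d < f →
    (![a, b, c, d, f] = ![0, 1, 2, 3, 4] ∨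
      ![a, b, c, d, f] = ![0, 1, 2, 3, 5] ∨
      ![a, b, c, d, f] = ![0, 1, 2, 3, 6] ∨
      ![a, b, c, d, f] = ![0, 1, 2, 4, 5] ∨
      ![a, b, c, d, f] = ![0, 1, 2, 4, 6] ∨
      ![a, b, c, d, f] = ![0, 1, 2, 5, 6] ∨
      ![a, b, c, d, f] = ![0, 1, 3, 4, 5] ∨
      ![a, b, c, d, f] = ![0, 1, 3, 4, 6] ∨
      ![a, b, c, d, f] = ![0, 1, 3, 5, 6] ∨
      ![a, b, c, d, f] = ![0, 1, 4, 5, 6] ∨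
      ![a, b, c, d, f] = ![0, 2, 3, 4, 5] ∨
      ![a, b, c, d, f] = ![0, 2, 3, 4, 6] ∨
      ![a, b, c, d, f] = ![0, 2, 3, 5, 6] ∨
      ![a, b, c, d, f] = ![0, 2, 4, 5, 6] ∨
      ![a, b, c, d, f] = ![0, 3, 4, 5, 6] ∨
      ![a, b, c, d, f] = ![1, 2, 3, 4, 5] ∨
      ![a, b, c, d, f] = ![1, 2, 3, 4, 6] ∨
      ![a, b, c, d, f] = ![1, 2, 3, 5, 6] ∨
      ![a, b, c, d, f] = ![1, 2, 4, 5, 6] ∨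
      ![a, b, c, d, f] = ![1, 3, 4, 5, 6] ∨
      ![a, b, c, d, f] = ![2, 3, 4, 5, 6]) := by
  decide +kernel

theorem phiBivec_self {V : Type*} [AddCommGroup V] [Module K V] (s : ℤ)
    (e : Module.Basis (Fin 7) K V) (ξ α : Module.Dual K V) :
    phiBivec s e ξ α α = 0 := by
  simp only [phiBivec_apply, bivec_apply]
  ring

theorem phiBivec_left {V : Type*} [AddCommGroup V] [Module K V] (s : ℤ)
    (e : Module.Basis (Fin 7) K V) (ξ β : Module.Dual K V) :
    phiBivec s e ξ ξ β = 0 := by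
  simp only [phiBivec_apply, bivec_apply]
  ring

theorem lieExtDeriv_psi_eq_zero_iff {s : ℤ} (hs : s = 1 ∨ s = -1) {ξ : Module.Dual K 𝔤}
    {A : 𝔤 →ₗ[K] 𝔤} (hbr : ∀ v w : 𝔤, ⁅v, w⁆ = ξ v • A w - ξ w • A v)
    (hA : ∀ v, ξ (A v) = 0) (e : Module.Basis (Fin 7) K 𝔤) :
    lieExtDeriv (psi s e) = 0 ↔ IsTraceBivector A ξ (phiBivec s e ξ) := by
  have hb := lieExtDeriv_psi_basis hs hbr hA e
  constructor
  · intro h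
    simp only [h, Pi.zero_apply, eq_comm (a := (0 : K)), neg_eq_zero] at hb
    obtain ⟨d1, d2, d3, d4, d5, d6, d7, d8, d9, d10, d11, d12, d13, d14, d15, d16, d17, d18, d19,
      d20, d21⟩ := hb
    refine ⟨phiBivec_self s e ξ, phiBivec_left s e ξ, ?_⟩
    let B := phiBivec s e ξ
    -- The defect as a bilinear form is alternating, so its 21 values on pairs `k < l` determine it.
    let T : LinearMap.BilinForm K (Module.Dual K 𝔤) :=
      B.compl₁₂ A.dualMap LinearMap.id + B.compl₁₂ LinearMap.id A.dualMap -
        LinearMap.trace K 𝔤 A • B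
    have hT (α β : Module.Dual K 𝔤) : T α β = traceDefect A B α β := rfl
    have hTc (α β : Module.Dual K 𝔤) : T α β = -T β α := by
      rw [hT, hT, traceDefect, traceDefect, phiBivec_comm s e ξ α β,
        phiBivec_comm s e ξ (α ∘ₗ A) β, phiBivec_comm s e ξ α (β ∘ₗ A)]
      ring
    have hTs (α : Module.Dual K 𝔤) : T α α = 0 := by
      rw [hT, traceDefect, phiBivec_comm s e ξ (α ∘ₗ A) α, phiBivec_self]
      ring
    have key (k l : Fin 7) (hkl : k < l) : T (e.coord k) (e.coord l) = 0 := by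
      rw [hT]
      fin_cases k <;> fin_cases l <;> first | exact absurd hkl (by decide) | assumption
    have hT0 : T = 0 := by
      refine LinearMap.BilinForm.ext_basis e.dualBasis fun k l => ?_
      rw [Module.Basis.coe_dualBasis]
      rcases lt_trichotomy k l with h | rfl | h
      · exact key k l h
      · exact hTs _
      · rw [hTc, key l k h, neg_zero]
        rfl
    intro α β
    have := hT α β
    rw [hT0, traceDefect] at this
    exact (sub_eq_zero.1 this.symm)
  · intro h
    have ht (α β : Module.Dual K 𝔤) : traceDefect A (phiBivec s e ξ) α β = 0 := by
      rw [traceDefect, h.trace, sub_self]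
    simp only [ht, neg_zero] at hb
    obtain ⟨d1, d2, d3, d4, d5, d6, d7, d8, d9, d10, d11, d12, d13, d14, d15, d16, d17, d18, d19,
      d20, d21⟩ := hb
    have hD : derivWedge ξ A (psi s e) = 0 := by
      refine alternatingMap_ext_strictMono e fun J hJ => ?_
      have hJ' : ![J 0, J 1, J 2, J 3, J 4] = J := by ext i; fin_cases i <;> rfl
      have hJ5 := strictMono_five_seven (J 0) (J 1) (hJ (by decide)) (J 2) (hJ (by decide)) (J 3)
        (hJ (by decide)) (J 4) (hJ (by decide))
      rw [hJ'] at hJ5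
      rw [AlternatingMap.zero_apply, ← neg_eq_zero, ← lieExtDeriv_eq_neg_derivWedge hbr]
      rcases hJ5 with rfl | rfl | rfl | rfl | rfl | rfl | rfl | rfl | rfl | rfl | rfl | rfl | rfl | rfl | rfl | rfl | rfl | rfl | rfl | rfl | rfl
      exacts [d1, d2, d3, d4, d5, d6, d7, d8, d9, d10, d11, d12, d13, d14, d15, d16, d17, d18, d19,
        d20, d21]
    funext v
    rw [lieExtDeriv_eq_neg_derivWedge hbr, hD]
    simp

end LieAlgebra

/-! ### The rank of the contracted bivector. -/

section Rank
variable {K V : Type*} [Field K] [AddCommGroup V] [Module K V]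

/-- The Pfaffian of `B` on four covectors. -/
def pfaffian4 {W : Type*} [AddCommGroup W] [Module K W] (B : LinearMap.BilinForm K W)
    (α β γ δ : W) : K :=
  B α β * B γ δ - B α γ * B β δ + B α δ * B β γ

theorem phiBivec_coord_coord (s : ℤ) (e : Module.Basis (Fin 7) K V) (ξ : Module.Dual K V) :
    phiBivec s e ξ (e.coord 0) (e.coord 1) = s * ξ (e 6) ∧
    phiBivec s e ξ (e.coord 0) (e.coord 2) = ξ (e 4) ∧
    phiBivec s e ξ (e.coord 0) (e.coord 3) = -ξ (e 5) ∧
    phiBivec s e ξ (e.coord 0) (e.coord 4) = -ξ (e 2) ∧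
    phiBivec s e ξ (e.coord 0) (e.coord 5) = ξ (e 3) ∧
    phiBivec s e ξ (e.coord 0) (e.coord 6) = -(s * ξ (e 1)) ∧
    phiBivec s e ξ (e.coord 1) (e.coord 2) = -ξ (e 5) ∧
    phiBivec s e ξ (e.coord 1) (e.coord 3) = -ξ (e 4) ∧
    phiBivec s e ξ (e.coord 1) (e.coord 4) = ξ (e 3) ∧
    phiBivec s e ξ (e.coord 1) (e.coord 5) = ξ (e 2) ∧
    phiBivec s e ξ (e.coord 1) (e.coord 6) = s * ξ (e 0) ∧
    phiBivec s e ξ (e.coord 2) (e.coord 3) = s * ξ (e 6) ∧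
    phiBivec s e ξ (e.coord 2) (e.coord 4) = ξ (e 0) ∧
    phiBivec s e ξ (e.coord 2) (e.coord 5) = -ξ (e 1) ∧
    phiBivec s e ξ (e.coord 2) (e.coord 6) = -(s * ξ (e 3)) ∧
    phiBivec s e ξ (e.coord 3) (e.coord 4) = -ξ (e 1) ∧
    phiBivec s e ξ (e.coord 3) (e.coord 5) = -ξ (e 0) ∧
    phiBivec s e ξ (e.coord 3) (e.coord 6) = s * ξ (e 2) ∧
    phiBivec s e ξ (e.coord 4) (e.coord 5) = ξ (e 6) ∧
    phiBivec s e ξ (e.coord 4) (e.coord 6) = -ξ (e 5) ∧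
    phiBivec s e ξ (e.coord 5) (e.coord 6) = ξ (e 4) := by
  have hc (α : Module.Dual K V) := phiBivec_coord_right s e ξ α
  simp only [hc, coord_basis]
  simp only [Fin.reduceEq, if_true, if_false]
  and_intros <;> ring

/-- The seven monomials of `phi s e` are the lines of a Fano plane. The Pfaffian on the complement
of a line is, up to sign, the sum of the squares `ξ (e i) ^ 2` over that line, weighted by the
metric signs. No assumption that `ξ` is non-null is needed, so null covectors still give rank at
least four. -/
theorem exists_pfaffian4_phiBivec_ne_zero [CharZero K] {s : ℤ} (hs : s = 1 ∨ s = -1)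
    (e : Module.Basis (Fin 7) K V) {ξ : Module.Dual K V} (hξ : ξ ≠ 0) :
    ∃ α β γ δ, pfaffian4 (phiBivec s e ξ) α β γ δ ≠ 0 := by
  by_contra! h
  obtain ⟨b01, b02, b03, b04, b05, b06, b12, b13, b14, b15, b16, b23, b24, b25, b26, b34, b35,
    b36, b45, b46, b56⟩ := phiBivec_coord_coord s e ξ
  have s1 := h (e.coord 2) (e.coord 3) (e.coord 4) (e.coord 5)
  have s2 := h (e.coord 0) (e.coord 1) (e.coord 4) (e.coord 5)
  have s3 := h (e.coord 0) (e.coord 1) (e.coord 2) (e.coord 3)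
  have s4 := h (e.coord 1) (e.coord 3) (e.coord 5) (e.coord 6)
  have s5 := h (e.coord 1) (e.coord 2) (e.coord 4) (e.coord 6)
  have s6 := h (e.coord 0) (e.coord 3) (e.coord 4) (e.coord 6)
  have s7 := h (e.coord 0) (e.coord 2) (e.coord 5) (e.coord 6)
  simp only [pfaffian4, b01, b02, b03, b04, b05, b06, b12, b13, b14, b15, b16, b23, b24, b25, b26,
    b34, b35, b36, b45, b46, b56] at s1 s2 s3 s4 s5 s6 s7
  -- Three lines pass through each point and every other point lies on exactly one of them. Thus
  -- three times the sum over the lines through `i`, minus the sum over all seven lines, is six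
  -- times the weighted square at `i`.
  have key : ∀ i, (6 : K) * ξ (e i) ^ 2 = 0 := by
    intro i
    rcases hs with rfl | rfl
    · push_cast at s1 s2 s3 s4 s5 s6 s7
      fin_cases i
      all_goals simp only [Fin.zero_eta, Fin.mk_one, Fin.reduceFinMk]
      · linear_combination (3 * (s1 - s4 + s5) - (s1 + s2 + s3 - s4 + s5 + s6 + s7))
      · linear_combination (3 * (s1 + s6 + s7) - (s1 + s2 + s3 - s4 + s5 + s6 + s7))
      · linear_combination (3 * (s2 - s4 + s6) - (s1 + s2 + s3 - s4 + s5 + s6 + s7))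
      · linear_combination (3 * (s2 + s5 + s7) - (s1 + s2 + s3 - s4 + s5 + s6 + s7))
      · linear_combination (3 * (s3 - s4 + s7) - (s1 + s2 + s3 - s4 + s5 + s6 + s7))
      · linear_combination (3 * (s3 + s5 + s6) - (s1 + s2 + s3 - s4 + s5 + s6 + s7))
      · linear_combination (3 * (s1 + s2 + s3) - (s1 + s2 + s3 - s4 + s5 + s6 + s7))
    · push_cast at s1 s2 s3 s4 s5 s6 s7
      fin_cases i
      all_goals simp only [Fin.zero_eta, Fin.mk_one, Fin.reduceFinMk]
      · linear_combination -(3 * (-s1 - s4 + s5) - (-s1 - s2 + s3 - s4 + s5 + s6 + s7))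
      · linear_combination -(3 * (-s1 + s6 + s7) - (-s1 - s2 + s3 - s4 + s5 + s6 + s7))
      · linear_combination -(3 * (-s2 - s4 + s6) - (-s1 - s2 + s3 - s4 + s5 + s6 + s7))
      · linear_combination -(3 * (-s2 + s5 + s7) - (-s1 - s2 + s3 - s4 + s5 + s6 + s7))
      · linear_combination (3 * (s3 - s4 + s7) - (-s1 - s2 + s3 - s4 + s5 + s6 + s7))
      · linear_combination (3 * (s3 + s5 + s6) - (-s1 - s2 + s3 - s4 + s5 + s6 + s7))
      · linear_combination (3 * (-s1 - s2 + s3) - (-s1 - s2 + s3 - s4 + s5 + s6 + s7))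
  exact hξ (e.ext fun i => by simpa using key i)

/-- For the cross product defined by the three-form, `ξ × (ξ × α) = g(ξ, α) ξ - g(ξ, ξ) α` on
covectors. If `ξ × α = 0` and `ξ` is non-null, this solves for `α`; the linear combinations below
are the identity in coordinates. -/
theorem phiBivec_radical {s : ℤ} (hs : s = 1 ∨ s = -1) (e : Module.Basis (Fin 7) K V)
    {ξ α : Module.Dual K V} (hξ : ξ (sharp s e ξ) ≠ 0) (h : ∀ β, phiBivec s e ξ α β = 0) :
    ∃ c : K, α = c • ξ := by
  have hs2 : (s : K) * s = 1 := by rcases hs with rfl | rfl <;> simp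
  obtain ⟨b0, b1, b2, b3, b4, b5, b6⟩ := phiBivec_coord_right s e ξ α
  rw [h] at b0 b1 b2 b3 b4 b5 b6
  have hp (α : Module.Dual K V) : α (sharp s e ξ) = s * (ξ (e 0) * α (e 0))
      + s * (ξ (e 1) * α (e 1)) + s * (ξ (e 2) * α (e 2)) + s * (ξ (e 3) * α (e 3))
      + ξ (e 4) * α (e 4) + ξ (e 5) * α (e 5) + ξ (e 6) * α (e 6) := by
    simp only [sharp, Fin.sum_univ_seven, metricSign, map_add, map_smul, smul_eq_mul, mul_assoc]
    simp [show (3 : Fin 7) < 4 by decide, show (2 : Fin 7) < 4 by decide,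
      show (1 : Fin 7) < 4 by decide, show ¬ (5 : Fin 7) < 4 by decide,
      show ¬ (6 : Fin 7) < 4 by decide]
  refine ⟨α (sharp s e ξ) / ξ (sharp s e ξ), e.ext fun m => ?_⟩
  rw [LinearMap.smul_apply, smul_eq_mul, div_mul_eq_mul_div, eq_div_iff hξ, hp, hp]
  rcases hs with rfl | rfl
  all_goals
    push_cast at b0 b1 b2 b3 b4 b5 b6 ⊢
    simp only [one_mul, neg_mul] at b0 b1 b2 b3 b4 b5 b6 ⊢
    fin_cases m
    all_goals simp only [Fin.zero_eta, Fin.mk_one, Fin.reduceFinMk]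
  · linear_combination -(ξ (e 6) * b1 + ξ (e 4) * b2 - ξ (e 5) * b3 - ξ (e 2) * b4 + ξ (e 3) * b5 - ξ (e 1) * b6)
  · linear_combination -(- ξ (e 6) * b0 - ξ (e 5) * b2 - ξ (e 4) * b3 + ξ (e 3) * b4 + ξ (e 2) * b5 + ξ (e 0) * b6)
  · linear_combination -(- ξ (e 4) * b0 + ξ (e 5) * b1 + ξ (e 6) * b3 + ξ (e 0) * b4 - ξ (e 1) * b5 - ξ (e 3) * b6)
  · linear_combination -(ξ (e 5) * b0 + ξ (e 4) * b1 - ξ (e 6) * b2 - ξ (e 1) * b4 - ξ (e 0) * b5 + ξ (e 2) * b6)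
  · linear_combination -(ξ (e 2) * b0 - ξ (e 3) * b1 - ξ (e 0) * b2 + ξ (e 1) * b3 + ξ (e 6) * b5 - ξ (e 5) * b6)
  · linear_combination -(- ξ (e 3) * b0 - ξ (e 2) * b1 + ξ (e 1) * b2 + ξ (e 0) * b3 - ξ (e 6) * b4 + ξ (e 4) * b6)
  · linear_combination -(ξ (e 1) * b0 - ξ (e 0) * b1 + ξ (e 3) * b2 - ξ (e 2) * b3 + ξ (e 5) * b4 - ξ (e 4) * b5)
  · linear_combination -(- ξ (e 6) * b1 + ξ (e 4) * b2 - ξ (e 5) * b3 + ξ (e 2) * b4 - ξ (e 3) * b5 - ξ (e 1) * b6)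
  · linear_combination -(ξ (e 6) * b0 - ξ (e 5) * b2 - ξ (e 4) * b3 - ξ (e 3) * b4 - ξ (e 2) * b5 + ξ (e 0) * b6)
  · linear_combination -(- ξ (e 4) * b0 + ξ (e 5) * b1 - ξ (e 6) * b3 - ξ (e 0) * b4 + ξ (e 1) * b5 - ξ (e 3) * b6)
  · linear_combination -(ξ (e 5) * b0 + ξ (e 4) * b1 + ξ (e 6) * b2 + ξ (e 1) * b4 + ξ (e 0) * b5 + ξ (e 2) * b6)
  · linear_combination -(- ξ (e 2) * b0 + ξ (e 3) * b1 + ξ (e 0) * b2 - ξ (e 1) * b3 + ξ (e 6) * b5 - ξ (e 5) * b6)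
  · linear_combination -(ξ (e 3) * b0 + ξ (e 2) * b1 - ξ (e 1) * b2 - ξ (e 0) * b3 - ξ (e 6) * b4 + ξ (e 4) * b6)
  · linear_combination -(ξ (e 1) * b0 - ξ (e 0) * b1 + ξ (e 3) * b2 - ξ (e 2) * b3 + ξ (e 5) * b4 - ξ (e 4) * b5)
end Rank

/-! ### Independence of the metric and volume form from the adapted basis; non-degeneracy of
hyperplanes. -/

section Metric
variable {K V : Type*} [Field K] [AddCommGroup V] [Module K V]

theorem prod_metricSign {s : ℤ} (hs : s = 1 ∨ s = -1) : ∏ i, metricSign s i = 1 := by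
  rcases hs with rfl | rfl <;> decide +kernel

theorem toMatrix_metric (s : ℤ) (e : Module.Basis (Fin 7) K V) :
    LinearMap.BilinForm.toMatrix e (metric s e) =
      Matrix.diagonal fun i => (metricSign s i : K) := by
  ext i j
  rw [LinearMap.BilinForm.toMatrix_apply, metric_apply_basis, Matrix.diagonal_apply]

theorem det_toMatrix_metric {s : ℤ} (hs : s = 1 ∨ s = -1) (e : Module.Basis (Fin 7) K V) :
    (LinearMap.BilinForm.toMatrix e (metric s e)).det = 1 := by
  have h : ((∏ i, metricSign s i : ℤ) : K) = 1 := by rw [prod_metricSign hs, Int.cast_one]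
  rw [toMatrix_metric, Matrix.det_diagonal, ← h, Int.cast_prod]

theorem coordForm_id_smul_metric [CharZero K] {s t : ℤ} (hs : s = 1 ∨ s = -1)
    (ht : t = 1 ∨ t = -1) {e f : Module.Basis (Fin 7) K V} (h : phi s e = phi t f) :
    coordForm e id f • metric s e = metric t f := by
  rw [(metricRelation_iff f (phi s e) (metric s e) (coordForm e id)).1
    (metricRelation_phi hs e), h, contractionForm_phi ht]

theorem pow_nine_eq_one {c : K} (h : c ^ 7 * c ^ 2 = 1) : c ^ 9 = 1 := by
  rw [← h, ← pow_add]

theorem det_toMatrix_metric_eq_sq {s : ℤ} (hs : s = 1 ∨ s = -1)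
    (e f : Module.Basis (Fin 7) K V) :
    (LinearMap.BilinForm.toMatrix f (metric s e)).det = (coordForm e id f) ^ 2 := by
  have h (A B D : Matrix (Fin 7) (Fin 7) K) (h : A.transpose * B * A = D) (hB : B.det = 1) :
      D.det = A.det ^ 2 := by
    rw [← h, Matrix.det_mul, Matrix.det_mul, hB, Matrix.det_transpose, mul_one, sq]
  rw [h _ _ _ (LinearMap.BilinForm.toMatrix_mul_basis_toMatrix e f _) (det_toMatrix_metric hs e),
    coordForm_id_apply, Module.Basis.det_apply]

/-- Let `c` be the volume of `f` measured by `e`. The metrics satisfy `c g_e = g_f`; in the basis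
`f` the determinants are `c ^ 7 * c ^ 2` on the left and `1` on the right. Over an ordered field
this forces `c = 1`. Different signs `s`, `t` are allowed because `IsInducedMetric` quantifies over
both kinds of adapted basis. -/
theorem coordForm_id_pow_nine [CharZero K] {s t : ℤ} (hs : s = 1 ∨ s = -1)
    (ht : t = 1 ∨ t = -1) {e f : Module.Basis (Fin 7) K V} (h : phi s e = phi t f) :
    (coordForm e id f) ^ 9 = 1 := by
  have h1 := coordForm_id_smul_metric hs ht h
  have h3 := det_toMatrix_metric ht f
  rw [← h1, map_smul, Matrix.det_smul, Fintype.card_fin,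
    det_toMatrix_metric_eq_sq hs] at h3
  exact pow_nine_eq_one h3

theorem abs_metricSign {s : ℤ} (hs : s = 1 ∨ s = -1) (i : Fin 7) : |metricSign s i| = 1 := by
  unfold metricSign
  rcases hs with rfl | rfl <;> split_ifs <;> simp

/-- The kernel of `ξ` is the orthogonal complement of `sharp s e ξ`, so it is non-degenerate exactly
when that vector is non-null. -/
theorem metric_ker_nondegenerate_iff {s : ℤ} (hs : s = 1 ∨ s = -1) (e : Module.Basis (Fin 7) K V)
    {ξ : Module.Dual K V} (hξ : ξ ≠ 0) :
    ((metric s e).restrict (LinearMap.ker ξ)).Nondegenerate ↔ ξ (sharp s e ξ) ≠ 0 := by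
  have hsharp (v : V) : metric s e (sharp s e ξ) v = ξ v := by rw [metric_sharp hs]
  constructor
  · intro h h0
    have h1 := h.1 ⟨sharp s e ξ, h0⟩ fun w => by
      change metric s e (sharp s e ξ) w = 0
      rw [hsharp]
      exact w.2
    have h2 : sharp s e ξ = 0 := congrArg Subtype.val h1
    refine hξ (LinearMap.ext fun v => ?_)
    rw [← hsharp, h2]
    simp
  · intro h
    have key (u : LinearMap.ker ξ) (hu : ∀ w : LinearMap.ker ξ, metric s e u w = 0) : u = 0 := by
      have h1 (v : V) : metric s e u v = 0 := by
        have h2 : v - (ξ v / ξ (sharp s e ξ)) • sharp s e ξ ∈ LinearMap.ker ξ := by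
          rw [LinearMap.mem_ker, map_sub, map_smul, smul_eq_mul, div_mul_cancel₀ _ h, sub_self]
        have h3 := hu ⟨_, h2⟩
        have h4 : metric s e u (sharp s e ξ) = 0 := by
          rw [metric_comm, hsharp]
          exact u.2
        simpa [map_sub, h4] using h3
      have h2 : metric s e u = 0 := LinearMap.ext h1
      have h3 := sharp_metric hs e (u : V)
      rw [h2] at h3
      ext
      rw [← h3]
      simp [sharp]
    exact ⟨fun u hu => key u hu, fun u hu => key u fun w => by
      rw [metric_comm]
      exact hu w⟩

end Metric

section Ordered
variable {K V : Type*} [Field K] [LinearOrder K] [IsStrictOrderedRing K] [AddCommGroup V]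
  [Module K V]

theorem eq_one_of_pow_nine {c : K} (h : c ^ 9 = 1) : c = 1 :=
  (Odd.pow_inj (n := 9) ⟨4, rfl⟩).1 (h.trans (one_pow 9).symm)

theorem coordForm_id_eq_one_of_phi_eq {s t : ℤ} (hs : s = 1 ∨ s = -1) (ht : t = 1 ∨ t = -1)
    {e f : Module.Basis (Fin 7) K V} {vol : V [⋀^Fin 7]→ₗ[K] K} (hvol : vol = coordForm e id)
    (h : phi s e = phi t f) : vol f = 1 ∧ metric s e = metric t f := by
  have h1 := coordForm_id_smul_metric hs ht h
  have h2 : coordForm e id f = 1 := eq_one_of_pow_nine (coordForm_id_pow_nine hs ht h)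
  rw [h2, one_smul] at h1
  exact ⟨by rw [hvol, h2], h1⟩

end Ordered

section Real
variable {V : Type*} [AddCommGroup V] [Module ℝ V]

theorem isInducedMetric_phi {s : ℤ} (hs : s = 1 ∨ s = -1) (e : Module.Basis (Fin 7) ℝ V) :
    IsInducedMetric (phi s e) (metric s e) (coordForm e id) := by
  have hrel := metricRelation_phi hs e
  obtain ⟨vol, hvol⟩ : ∃ vol, vol = coordForm e id := ⟨_, rfl⟩
  rw [← hvol] at hrel ⊢
  refine ⟨hrel, fun f hf => ?_⟩
  obtain ⟨t, ht, h⟩ : ∃ t : ℤ, (t = 1 ∨ t = -1) ∧ phi s e = phi t f := by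
    rcases hf with hf | hf
    · exact ⟨1, Or.inl rfl, hf.trans (phi_one f).symm⟩
    · exact ⟨-1, Or.inr rfl, hf.trans (phi_neg_one f).symm⟩
  obtain ⟨h3, h1⟩ := coordForm_id_eq_one_of_phi_eq hs ht hvol h
  refine ⟨h3, fun i j => ?_⟩
  rw [h1, metric_apply_basis]
  split_ifs
  · rw [← Int.cast_abs, abs_metricSign ht, Int.cast_one]
  · exact abs_zero

theorem IsInducedMetric.eq {s : ℤ} (hs : s = 1 ∨ s = -1) {e : Module.Basis (Fin 7) ℝ V}
    {g : LinearMap.BilinForm ℝ V} {vol : V [⋀^Fin 7]→ₗ[ℝ] ℝ}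
    (h : IsInducedMetric (phi s e) g vol) : g = metric s e ∧ vol = coordForm e id := by
  have hvol : vol e = 1 := by
    refine (h.orthonormal e ?_).1
    rcases hs with rfl | rfl
    · exact Or.inl (phi_one e)
    · exact Or.inr (phi_neg_one e)
  exact ⟨h.relation.eq_metric hs hvol, topForm_ext e (by rw [hvol, coordForm_id_self])⟩

end Real

/-! ### Cocalibrated structures as solutions of the bivector equation. -/

section LieAlgebra
variable {K 𝔤 : Type*} [Field K] [CharZero K] [LieRing 𝔤] [LieAlgebra K 𝔤]

theorem hasClosedHodgeDual_phi_iff {s : ℤ} (hs : s = 1 ∨ s = -1) {ξ : Module.Dual K 𝔤}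
    {A : 𝔤 →ₗ[K] 𝔤} (hbr : ∀ v w : 𝔤, ⁅v, w⁆ = ξ v • A w - ξ w • A v)
    (hA : ∀ v, ξ (A v) = 0) (e : Module.Basis (Fin 7) K 𝔤) :
    HasClosedHodgeDual (metric s e) (coordForm e id) (phi s e) ↔
      IsTraceBivector A ξ (phiBivec s e ξ) := by
  rw [← lieExtDeriv_psi_eq_zero_iff hs hbr hA]
  constructor
  · rintro ⟨Ψ, h1, h2⟩
    rwa [← IsHodgeDual.eq_psi hs h1]
  · exact fun h => ⟨psi s e, isHodgeDual_psi hs e, h⟩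

end LieAlgebra

section RealLie
variable {𝔤 : Type*} [LieRing 𝔤] [LieAlgebra ℝ 𝔤] {ξ : Module.Dual ℝ 𝔤} {A : 𝔤 →ₗ[ℝ] 𝔤}

theorem admitsCocalibratedG2_iff (hbr : ∀ v w : 𝔤, ⁅v, w⁆ = ξ v • A w - ξ w • A v)
    (hA : ∀ v, ξ (A v) = 0) :
    AdmitsCocalibratedG2 𝔤 ↔
      ∃ e : Module.Basis (Fin 7) ℝ 𝔤, IsTraceBivector A ξ (phiBivec 1 e ξ) := by
  have hs : (1 : ℤ) = 1 ∨ (1 : ℤ) = -1 := Or.inl rfl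
  constructor
  · rintro ⟨φ, g, vol, ⟨e, rfl⟩, h1, h2⟩
    rw [← phi_one] at h1 h2
    obtain ⟨rfl, rfl⟩ := h1.eq hs
    exact ⟨e, (hasClosedHodgeDual_phi_iff hs hbr hA e).1 h2⟩
  · rintro ⟨e, he⟩
    exact ⟨phi 1 e, metric 1 e, coordForm e id, ⟨e, phi_one e⟩, isInducedMetric_phi hs e,
      (hasClosedHodgeDual_phi_iff hs hbr hA e).2 he⟩

theorem admitsCocalibratedG2Star_iff (hbr : ∀ v w : 𝔤, ⁅v, w⁆ = ξ v • A w - ξ w • A v)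
    (hA : ∀ v, ξ (A v) = 0) :
    AdmitsCocalibratedG2Star 𝔤 ↔
      ∃ e : Module.Basis (Fin 7) ℝ 𝔤, IsTraceBivector A ξ (phiBivec (-1) e ξ) := by
  have hs : (-1 : ℤ) = 1 ∨ (-1 : ℤ) = -1 := Or.inr rfl
  constructor
  · rintro ⟨φ, g, vol, ⟨e, rfl⟩, h1, h2⟩
    rw [← phi_neg_one] at h1 h2
    obtain ⟨rfl, rfl⟩ := h1.eq hs
    exact ⟨e, (hasClosedHodgeDual_phi_iff hs hbr hA e).1 h2⟩
  · rintro ⟨e, he⟩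
    exact ⟨phi (-1) e, metric (-1) e, coordForm e id, ⟨e, phi_neg_one e⟩,
      isInducedMetric_phi hs e, (hasClosedHodgeDual_phi_iff hs hbr hA e).2 he⟩

theorem admitsCocalibratedG2StarNondeg_iff (hbr : ∀ v w : 𝔤, ⁅v, w⁆ = ξ v • A w - ξ w • A v)
    (hA : ∀ v, ξ (A v) = 0) (hξ : ξ ≠ 0) :
    AdmitsCocalibratedG2StarNondeg 𝔤 (LinearMap.ker ξ) ↔
      ∃ e : Module.Basis (Fin 7) ℝ 𝔤, IsTraceBivector A ξ (phiBivec (-1) e ξ) ∧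
        ξ (sharp (-1) e ξ) ≠ 0 := by
  have hs : (-1 : ℤ) = 1 ∨ (-1 : ℤ) = -1 := Or.inr rfl
  constructor
  · rintro ⟨φ, g, vol, ⟨⟨e, rfl⟩, h1, h2⟩, h3⟩
    rw [← phi_neg_one] at h1 h2
    obtain ⟨rfl, rfl⟩ := h1.eq hs
    exact ⟨e, (hasClosedHodgeDual_phi_iff hs hbr hA e).1 h2,
      (metric_ker_nondegenerate_iff hs e hξ).1 h3⟩
  · rintro ⟨e, he, h3⟩
    exact ⟨phi (-1) e, metric (-1) e, coordForm e id, ⟨⟨e, phi_neg_one e⟩,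
      isInducedMetric_phi hs e, (hasClosedHodgeDual_phi_iff hs hbr hA e).2 he⟩,
      (metric_ker_nondegenerate_iff hs e hξ).2 h3⟩

end RealLie

section ComplexLie
variable {𝔤 : Type*} [LieRing 𝔤] [LieAlgebra ℂ 𝔤] {ξ : Module.Dual ℂ 𝔤} {A : 𝔤 →ₗ[ℂ] 𝔤}

theorem IsCocalibratedG2Complex.exists_basis
    (hbr : ∀ v w : 𝔤, ⁅v, w⁆ = ξ v • A w - ξ w • A v) (hA : ∀ v, ξ (A v) = 0)
    {φ : 𝔤 [⋀^Fin 3]→ₗ[ℂ] ℂ} {g : LinearMap.BilinForm ℂ 𝔤} {vol : 𝔤 [⋀^Fin 7]→ₗ[ℂ] ℂ}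
    (h : IsCocalibratedG2Complex φ g vol) :
    ∃ e : Module.Basis (Fin 7) ℂ 𝔤, g = metric 1 e ∧ IsTraceBivector A ξ (phiBivec 1 e ξ) := by
  have hs : (1 : ℤ) = 1 ∨ (1 : ℤ) = -1 := Or.inl rfl
  obtain ⟨⟨e, rfl, rfl⟩, h1, h2⟩ := h
  rw [← phi_one] at h1 h2
  obtain rfl := h1.eq_metric hs (coordForm_id_self e)
  exact ⟨e, rfl, (hasClosedHodgeDual_phi_iff hs hbr hA e).1 h2⟩

theorem isCocalibratedG2Complex_phi_one
    (hbr : ∀ v w : 𝔤, ⁅v, w⁆ = ξ v • A w - ξ w • A v) (hA : ∀ v, ξ (A v) = 0)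
    {e : Module.Basis (Fin 7) ℂ 𝔤} (he : IsTraceBivector A ξ (phiBivec 1 e ξ)) :
    IsCocalibratedG2Complex (phi 1 e) (metric 1 e) (coordForm e id) := by
  have hs : (1 : ℤ) = 1 ∨ (1 : ℤ) = -1 := Or.inl rfl
  exact ⟨⟨e, rfl, phi_one e⟩, metricRelation_phi hs e,
    (hasClosedHodgeDual_phi_iff hs hbr hA e).2 he⟩

theorem coordForm_unitsSMul {K V : Type*} [Field K] [AddCommGroup V] [Module K V] {n k : ℕ}
    (e : Module.Basis (Fin n) K V) (w : Fin n → Kˣ) (I : Fin k → Fin n) :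
    coordForm (e.unitsSMul w) I = (∏ a, ((w (I a))⁻¹ : Kˣ) : K) • coordForm e I := by
  ext v
  rw [AlternatingMap.smul_apply, coordForm, coordForm, wedgeCovectors_apply, wedgeCovectors_apply,
    smul_eq_mul, ← Matrix.det_mul_row]
  congr 1
  ext i j
  simp [Units.smul_def]

/-- Over `ℂ`, the standard `G₂*`-form is the standard `G₂`-form of a rescaled basis. -/
theorem exists_phi_one_eq_phi_neg_one {W : Type*} [AddCommGroup W] [Module ℂ W]
    (e : Module.Basis (Fin 7) ℂ W) :
    ∃ f : Module.Basis (Fin 7) ℂ W, coordForm e id = coordForm f id ∧ phi (-1) e = g2Form f := by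
  let i : ℂˣ := Units.mk0 Complex.I Complex.I_ne_zero
  -- The weights have product one, which preserves the volume form. Two of the first four indices
  -- contribute `-1`; this is cancelled by the weight of `e 4` or `e 5` in every monomial except the
  -- two containing `e 6`.
  refine ⟨e.unitsSMul ![i, i, i, i, -1, -1, 1], ?_, ?_⟩
  · rw [coordForm_unitsSMul]
    have : (∏ a, ((![i, i, i, i, -1, -1, 1] (id a))⁻¹ : ℂˣ) : ℂ) = 1 := by
      simp [Fin.prod_univ_succ, i]
    rw [this, one_smul]
  · rw [phi_neg_one, g2StarForm, g2Form]
    simp only [coordForm_unitsSMul]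
    simp [Fin.prod_univ_succ, i]
    abel

theorem isCocalibratedG2Complex_phi_neg_one
    (hbr : ∀ v w : 𝔤, ⁅v, w⁆ = ξ v • A w - ξ w • A v) (hA : ∀ v, ξ (A v) = 0)
    {e : Module.Basis (Fin 7) ℂ 𝔤} (he : IsTraceBivector A ξ (phiBivec (-1) e ξ)) :
    IsCocalibratedG2Complex (phi (-1) e) (metric (-1) e) (coordForm e id) := by
  have hs : (-1 : ℤ) = 1 ∨ (-1 : ℤ) = -1 := Or.inr rfl
  exact ⟨exists_phi_one_eq_phi_neg_one e, metricRelation_phi hs e,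
    (hasClosedHodgeDual_phi_iff hs hbr hA e).2 he⟩

end ComplexLie

/-! ### Darboux bases for alternating forms of rank at least four. -/

section Darboux
variable {K V : Type*} [Field K] [AddCommGroup V] [Module K V]

/-- Two complementary hyperbolic pairs, spanning a four-dimensional symplectic subspace. -/
structure IsSymplecticQuadruple {W : Type*} [AddCommGroup W] [Module K W]
    (B : LinearMap.BilinForm K W) (a : Fin 4 → W) : Prop where
  h01 : B (a 0) (a 1) = 1
  h23 : B (a 2) (a 3) = 1
  h02 : B (a 0) (a 2) = 0
  h03 : B (a 0) (a 3) = 0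
  h12 : B (a 1) (a 2) = 0
  h13 : B (a 1) (a 3) = 0

theorem neg_swap_of_alt {W : Type*} [AddCommGroup W] [Module K W] {B : LinearMap.BilinForm K W}
    (hB : ∀ α, B α α = 0) (α β : W) : B α β = -B β α := by
  have h := hB (α + β)
  simp only [map_add, LinearMap.add_apply, hB] at h
  linear_combination h

/-- Symplectic Gram–Schmidt. Some `B α _` is non-zero, so after reordering `α, β` span a hyperbolic
plane; `γ` and `δ` are projected off it, and the pairing of the projections is the Pfaffian divided
by `B α β`. -/
theorem exists_isSymplecticQuadruple {W : Type*} [AddCommGroup W] [Module K W]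
    {B : LinearMap.BilinForm K W} (hB : ∀ α, B α α = 0) {α β γ δ : W}
    (h : pfaffian4 B α β γ δ ≠ 0) : ∃ a, IsSymplecticQuadruple B a := by
  have hsw := neg_swap_of_alt hB
  have key {α β γ δ : W} (hαβ : B α β ≠ 0) (h : pfaffian4 B α β γ δ ≠ 0) :
      ∃ a, IsSymplecticQuadruple B a := by
    refine ⟨![α, (B α β)⁻¹ • β, (pfaffian4 B α β γ δ)⁻¹ •
      (B α β • γ - B γ β • α + B γ α • β),
      δ - (B α β)⁻¹ • (B δ β • α - B δ α • β)], ?_, ?_, ?_, ?_, ?_, ?_⟩ <;>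
    simp only [Matrix.cons_val, map_add, map_sub, map_smul, LinearMap.add_apply,
      LinearMap.sub_apply, LinearMap.smul_apply, smul_eq_mul, hB, hsw γ β, hsw γ α, hsw δ β,
      hsw δ α, hsw β α]
    · field_simp
    · have : pfaffian4 B α β γ δ = B α β * B γ δ - B α γ * B β δ + B α δ * B β γ := rfl
      field_simp
      rw [this]
      ring
    all_goals field_simp; try ring
  by_cases h1 : B α β = 0
  · by_cases h2 : B α γ = 0
    · have h3 : B α δ ≠ 0 := fun h3 => h (by simp [pfaffian4, h1, h2, h3])
      refine key (γ := β) (δ := γ) h3 fun h4 => h ?_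
      simp only [pfaffian4] at h4 ⊢
      rw [hsw δ β, hsw δ γ] at h4
      linear_combination h4
    · refine key (γ := β) (δ := δ) h2 fun h4 => h ?_
      simp only [pfaffian4] at h4 ⊢
      rw [hsw γ β] at h4
      linear_combination -h4
  · exact key h1 h

theorem exists_linearIndependent_extension {M : Type*} [AddCommGroup M] [Module K M] {x : M}
    (hx : x ≠ 0) (h : 3 ≤ Module.finrank K M) : ∃ y z : M, LinearIndependent K ![z, y, x] := by
  have h1 : LinearIndependent K ![x] := LinearIndependent.of_subsingleton 0 hx
  obtain ⟨y, h2⟩ := exists_linearIndependent_cons_of_lt_finrank h1 (by omega)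
  obtain ⟨z, h3⟩ := exists_linearIndependent_cons_of_lt_finrank h2 (by omega)
  exact ⟨y, z, h3⟩

/-- A basis of a seven-dimensional space adapted to a degenerate alternating form. -/
theorem exists_adapted_basis {W : Type*} [AddCommGroup W] [Module K W]
    (hW : Module.finrank K W = 7) {B : LinearMap.BilinForm K W} (hB : ∀ α, B α α = 0) {ξ : W}
    (hξ : ξ ≠ 0) (hBξ : ∀ β, B ξ β = 0) {a : Fin 4 → W} (ha : IsSymplecticQuadruple B a) :
    ∃ b : Module.Basis (Fin 7) K W, b 0 = a 0 ∧ b 1 = a 1 ∧ b 2 = a 2 ∧ b 3 = a 3 ∧ b 6 = ξ ∧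
      (∀ i, B (b 4) (a i) = 0) ∧ ∀ i, B (b 5) (a i) = 0 := by
  have hsw := neg_swap_of_alt hB
  have : FiniteDimensional K W := Module.finite_of_finrank_pos (by omega)
  let p : W →ₗ[K] Fin 4 → K := LinearMap.pi fun i => B.flip (a i)
  have hp (w : W) : w ∈ LinearMap.ker p ↔ ∀ i, B w (a i) = 0 := by
    rw [LinearMap.mem_ker]
    exact ⟨fun h i => congrFun h i, fun h => funext h⟩
  have hN : 3 ≤ Module.finrank K (LinearMap.ker p) := by
    have h1 := LinearMap.finrank_range_add_finrank_ker p
    have h2 := Submodule.finrank_le (LinearMap.range p)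
    rw [Module.finrank_fin_fun] at h2
    omega
  -- The orthogonal of the quadruple has dimension at least three and contains `ξ`, so `ξ` extends
  -- inside it to three independent vectors.
  obtain ⟨y, z, hyz⟩ := exists_linearIndependent_extension
    (x := (⟨ξ, (hp ξ).2 fun i => hBξ _⟩ : LinearMap.ker p))
    (fun h => hξ (congrArg Subtype.val h)) hN
  have hy := (hp y).1 y.2
  have hz := (hp z).1 z.2
  have hli : LinearIndependent K ![a 0, a 1, a 2, a 3, (z : W), y, ξ] := by
    rw [Fintype.linearIndependent_iff]
    intro g hg
    rw [Fin.sum_univ_seven] at hg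
    simp only [Matrix.cons_val] at hg
    -- Pairing a linear relation with the quadruple removes the orthogonal part and isolates the
    -- first four coefficients.
    have e (i : Fin 4) := congrArg (fun w => B w (a i)) hg
    simp only [map_add, map_smul, LinearMap.add_apply, LinearMap.smul_apply, smul_eq_mul, hy, hz,
      hBξ, mul_zero, add_zero, map_zero, LinearMap.zero_apply] at e
    have e0 := e 0
    have e1 := e 1
    have e2 := e 2
    have e3 := e 3
    rw [hB, hsw (a 1) (a 0), hsw (a 2) (a 0), hsw (a 3) (a 0), ha.h01, ha.h02, ha.h03] at e0
    rw [hB, hsw (a 2) (a 1), hsw (a 3) (a 1), ha.h01, ha.h12, ha.h13] at e1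
    rw [hB, hsw (a 3) (a 2), ha.h02, ha.h12, ha.h23] at e2
    rw [hB, ha.h03, ha.h13, ha.h23] at e3
    have g0 : g 0 = 0 := by linear_combination e1
    have g1 : g 1 = 0 := by linear_combination -e0
    have g2 : g 2 = 0 := by linear_combination e3
    have g3 : g 3 = 0 := by linear_combination -e2
    rw [Fintype.linearIndependent_iff] at hyz
    have h3 := hyz ![g 4, g 5, g 6] (by
      rw [Fin.sum_univ_three]
      ext
      simpa [g0, g1, g2, g3] using hg)
    have g4 : g 4 = 0 := h3 0
    have g5 : g 5 = 0 := h3 1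
    have g6 : g 6 = 0 := h3 2
    intro i
    fin_cases i <;> assumption
  refine ⟨basisOfLinearIndependentOfCardEqFinrank hli (by simp [hW]), ?_⟩
  simp only [coe_basisOfLinearIndependentOfCardEqFinrank]
  exact ⟨rfl, rfl, rfl, rfl, rfl, hz, hy⟩

/-- Every basis of the dual space is a dual basis. -/
theorem exists_basis_coord_eq {ι : Type*} [Finite ι] [DecidableEq ι]
    (b : Module.Basis ι K (Module.Dual K V)) [FiniteDimensional K V] :
    ∃ f : Module.Basis ι K V, ∀ i, f.coord i = b i := by
  let f := b.dualBasis.map (Module.evalEquiv K V).symm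
  have hf (θ : Module.Dual K V) (i : ι) : θ (f i) = b.repr θ i := by
    have h : Module.evalEquiv K V (f i) = b.dualBasis i := by simp [f]
    have h2 := DFunLike.congr_fun h θ
    rwa [b.dualBasis_apply] at h2
  refine ⟨f, fun i => f.ext fun j => ?_⟩
  rw [hf (b i), Module.Basis.coord_apply, f.repr_self, b.repr_self, Finsupp.single_apply,
    Finsupp.single_apply]
  simp only [eq_comm]

/-- The bivector `f₀ ∧ f₁ + f₂ ∧ f₃ + c f₄ ∧ f₅`. -/
def normalBivec (c : K) (f : Fin 7 → V) : LinearMap.BilinForm K (Module.Dual K V) :=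
  bivec (f 0) (f 1) + bivec (f 2) (f 3) + c • bivec (f 4) (f 5)

theorem normalBivec_apply (c : K) (f : Fin 7 → V) (α β : Module.Dual K V) :
    normalBivec c f α β = (α (f 0) * β (f 1) - α (f 1) * β (f 0)) +
      (α (f 2) * β (f 3) - α (f 3) * β (f 2)) + c * (α (f 4) * β (f 5) - α (f 5) * β (f 4)) := rfl

/-- In the basis of covectors adapted to a symplectic quadruple and to `ξ`, the only value left
undetermined is the pairing of the two remaining covectors, and this is `c`. -/
theorem exists_eq_normalBivec (hV : Module.finrank K V = 7)
    {B : LinearMap.BilinForm K (Module.Dual K V)} (hB : ∀ α, B α α = 0) {ξ : Module.Dual K V}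
    (hξ : ξ ≠ 0) (hBξ : ∀ β, B ξ β = 0) {α β γ δ : Module.Dual K V}
    (h : pfaffian4 B α β γ δ ≠ 0) :
    ∃ (c : K) (f : Module.Basis (Fin 7) K V), ξ = f.coord 6 ∧ B = normalBivec c f := by
  have hsw := neg_swap_of_alt hB
  have : FiniteDimensional K V := Module.finite_of_finrank_pos (by omega)
  obtain ⟨a, ha⟩ := exists_isSymplecticQuadruple hB h
  obtain ⟨b, b0, b1, b2, b3, b6, b4, b5⟩ := exists_adapted_basis
    (Subspace.dual_finrank_eq.trans hV) hB hξ hBξ ha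
  obtain ⟨f, hf⟩ := exists_basis_coord_eq b
  refine ⟨B (b 4) (b 5), f, (hf 6).trans b6 |>.symm, ?_⟩
  have hBξ' (β) : B β ξ = 0 := by rw [hsw, hBξ, neg_zero]
  have hb (i j : Fin 7) : b i (f j) = if j = i then 1 else 0 := by
    rw [← hf, coord_basis]
    simp only [eq_comm]
  refine b.ext fun i => b.ext fun j => ?_
  rw [normalBivec_apply]
  simp only [hb]
  fin_cases i <;> fin_cases j <;> dsimp only <;>
    simp [b0, b1, b2, b3, b6, hB, hBξ, hBξ', hsw (a 1) (a 0), hsw (a 2) (a 0), hsw (a 3) (a 0),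
      hsw (a 2) (a 1), hsw (a 3) (a 1), hsw (a 3) (a 2), ha.h01, ha.h02, ha.h03, ha.h12, ha.h13,
      ha.h23, b4, b5, hsw (a _) (b 4), hsw (a _) (b 5), hsw (b 5) (b 4)]

end Darboux

/-! ### Reduction to two normal forms and their realisation by three-forms. -/

section NormalForm
variable {K V : Type*} [Field K] [AddCommGroup V] [Module K V]

/-- There is a trace bivector in the normal form with coefficient `c`. -/
def HasNormalForm (c : K) (A : V →ₗ[K] V) (ξ : Module.Dual K V) : Prop :=
  ∃ f : Module.Basis (Fin 7) K V, ξ = f.coord 6 ∧ IsTraceBivector A ξ (normalBivec c f)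

theorem HasNormalForm.of_ne_zero {c : K} (hc : c ≠ 0) {A : V →ₗ[K] V} {ξ : Module.Dual K V}
    (h : HasNormalForm c A ξ) : HasNormalForm 1 A ξ := by
  obtain ⟨f, rfl, h⟩ := h
  let w : Fin 7 → Kˣ := ![1, 1, 1, 1, Units.mk0 c hc, 1, 1]
  refine ⟨f.unitsSMul w, ?_, ?_⟩
  · ext v
    simp [w]
  · convert! h using 1
    ext α β
    simp [normalBivec_apply, w, Module.Basis.unitsSMul_apply, Units.smul_def]
    ring

theorem IsTraceBivector.hasNormalForm (hV : Module.finrank K V = 7) {A : V →ₗ[K] V}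
    {ξ : Module.Dual K V} (hξ : ξ ≠ 0) {B : LinearMap.BilinForm K (Module.Dual K V)}
    (hB : IsTraceBivector A ξ B) {α β γ δ : Module.Dual K V} (h : pfaffian4 B α β γ δ ≠ 0) :
    HasNormalForm 1 A ξ ∨ HasNormalForm 0 A ξ := by
  obtain ⟨c, f, hf, rfl⟩ := exists_eq_normalBivec hV hB.alt hξ hB.left h
  by_cases hc : c = 0
  · subst hc
    exact Or.inr ⟨f, hf, hB⟩
  · exact Or.inl (HasNormalForm.of_ne_zero hc ⟨f, hf, hB⟩)

/-- If `c` vanished, the covector `f.coord 4` would lie in the radical without being a multiple of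
`ξ = f.coord 6`. -/
theorem IsTraceBivector.hasNormalForm_one (hV : Module.finrank K V = 7) {A : V →ₗ[K] V}
    {ξ : Module.Dual K V} (hξ : ξ ≠ 0) {B : LinearMap.BilinForm K (Module.Dual K V)}
    (hB : IsTraceBivector A ξ B) {α β γ δ : Module.Dual K V} (h : pfaffian4 B α β γ δ ≠ 0)
    (hrad : ∀ α, (∀ β, B α β = 0) → ∃ c : K, α = c • ξ) : HasNormalForm 1 A ξ := by
  obtain ⟨c, f, hf, rfl⟩ := exists_eq_normalBivec hV hB.alt hξ hB.left h
  refine HasNormalForm.of_ne_zero (c := c) (fun hc => ?_) ⟨f, hf, hB⟩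
  obtain ⟨d, hd⟩ := hrad (f.coord 4) fun β => by
    simp [normalBivec_apply, hc]
  have := congrArg (fun θ : Module.Dual K V => θ (f 4)) hd
  simp [hf] at this

theorem IsTraceBivector.smul {A : V →ₗ[K] V} {ξ : Module.Dual K V}
    {B : LinearMap.BilinForm K (Module.Dual K V)} (hB : IsTraceBivector A ξ B) (c : K) :
    IsTraceBivector A ξ (c • B) where
  alt α := by simp [hB.alt]
  left β := by simp [hB.left]
  trace α β := by
    simp only [LinearMap.smul_apply, smul_eq_mul]
    linear_combination c * hB.trace α β

theorem HasNormalForm.exists_phiBivec {A : V →ₗ[K] V} {ξ : Module.Dual K V}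
    (h : HasNormalForm 1 A ξ) {s : ℤ} (hs : s = 1 ∨ s = -1) :
    ∃ e : Module.Basis (Fin 7) K V, IsTraceBivector A ξ (phiBivec s e ξ) ∧
      ξ (sharp s e ξ) ≠ 0 := by
  obtain ⟨f, rfl, h⟩ := h
  rcases hs with rfl | rfl
  · refine ⟨f, ?_, ?_⟩
    · convert! h using 1
      ext α β
      simp [phiBivec_apply, normalBivec_apply, bivec_apply]
    · simp [sharp, metricSign]
  -- For `s = -1` the contraction is `-e₀∧e₁ - e₂∧e₃ + e₄∧e₅`; the two swaps absorb the signs.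
  · let e := f.reindex (Equiv.swap 0 1 * Equiv.swap 2 3)
    have e0 : e 0 = f 1 := by rw [Module.Basis.reindex_apply]; rfl
    have e1 : e 1 = f 0 := by rw [Module.Basis.reindex_apply]; rfl
    have e2 : e 2 = f 3 := by rw [Module.Basis.reindex_apply]; rfl
    have e3 : e 3 = f 2 := by rw [Module.Basis.reindex_apply]; rfl
    have e4 : e 4 = f 4 := by rw [Module.Basis.reindex_apply]; rfl
    have e5 : e 5 = f 5 := by rw [Module.Basis.reindex_apply]; rfl
    have e6 : e 6 = f 6 := by rw [Module.Basis.reindex_apply]; rfl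
    refine ⟨e, ?_, ?_⟩
    · convert! h using 1
      ext α β
      simp [phiBivec_apply, normalBivec_apply, bivec_apply, e0, e1, e2, e3, e4, e5, e6]
    · simp [sharp, Fin.sum_univ_seven, metricSign, e0, e1, e2, e3, e4, e5, e6]

theorem HasNormalForm.exists_phiBivec_neg_one [CharZero K] {A : V →ₗ[K] V} {ξ : Module.Dual K V}
    (h : HasNormalForm 0 A ξ) :
    ∃ e : Module.Basis (Fin 7) K V, IsTraceBivector A ξ (phiBivec (-1) e ξ) := by
  obtain ⟨f, rfl, h⟩ := h
  -- These vectors solve `f₀ = e₀ + e₆`, `f₁ = -e₁`, `f₂ = -(e₂ + e₅)`, `f₃ = e₃ + e₄`, `f₄ = e₂ -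
  -- e₅`, `f₅ = e₃ - e₄`, `f₆ = e₆ - e₀`. Then `ξ` takes the values `-1/2` on `e₀`, `1/2` on `e₆`
  -- and zero on the others, so it is null, and the contraction collapses to half of `f₀∧f₁ +
  -- f₂∧f₃`.
  have hli : LinearIndependent K ![(2 : K)⁻¹ • (f 0 - f 6), -f 1, (2 : K)⁻¹ • (f 4 - f 2),
      (2 : K)⁻¹ • (f 3 + f 5), (2 : K)⁻¹ • (f 3 - f 5), (2 : K)⁻¹ • (-f 2 - f 4),
      (2 : K)⁻¹ • (f 0 + f 6)] := by
    rw [Fintype.linearIndependent_iff]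
    intro g hg
    rw [Fin.sum_univ_seven] at hg
    simp only [Matrix.cons_val] at hg
    have e (i : Fin 7) := congrArg (f.coord i) hg
    have e0 := e 0
    have e1 := e 1
    have e2 := e 2
    have e3 := e 3
    have e4 := e 4
    have e5 := e 5
    have e6 := e 6
    simp only [map_add, map_sub, map_neg, map_smul, coord_basis, map_zero, smul_eq_mul,
      Fin.reduceEq, if_true, if_false] at e0 e1 e2 e3 e4 e5 e6
    have g0 : g 0 = 0 := by linear_combination e0 - e6
    have g1 : g 1 = 0 := by linear_combination -e1
    have g2 : g 2 = 0 := by linear_combination e4 - e2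
    have g3 : g 3 = 0 := by linear_combination e3 + e5
    have g4 : g 4 = 0 := by linear_combination e3 - e5
    have g5 : g 5 = 0 := by linear_combination -e2 - e4
    have g6 : g 6 = 0 := by linear_combination e0 + e6
    intro i
    fin_cases i <;> assumption
  let e := basisOfLinearIndependentOfCardEqFinrank hli
    (by rw [Module.finrank_eq_card_basis f])
  have he : ⇑e = _ := coe_basisOfLinearIndependentOfCardEqFinrank _ _
  refine ⟨e, ?_⟩
  convert! h.smul (2 : K)⁻¹ using 1
  ext α β
  simp only [phiBivec_apply, normalBivec_apply, bivec_apply, he, Matrix.cons_val,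
    LinearMap.smul_apply, smul_eq_mul, map_add, map_sub, map_neg, map_smul, coord_basis,
    Fin.reduceEq, if_true, if_false]
  push_cast
  ring

end NormalForm

/-! ### A determinant that detects rank six. -/

section Radical
variable {K V : Type*} [Field K] [AddCommGroup V] [Module K V]

/-- For an alternating form `B` with `B ξ = 0` and a vector `X` with `ξ X = 1`, the form
`B + X ⊗ X` is non-degenerate if and only if the radical of `B` is spanned by `ξ`. -/
theorem det_ne_zero_iff_radical {ι : Type*} [Fintype ι] [DecidableEq ι]
    (b : Module.Basis ι K (Module.Dual K V)) {B : LinearMap.BilinForm K (Module.Dual K V)}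
    (hB : ∀ α, B α α = 0) {ξ : Module.Dual K V} (hBξ : ∀ β, B ξ β = 0) {X : V} (hX : ξ X = 1) :
    (Matrix.of fun i j => B (b i) (b j) + b i X * b j X).det ≠ 0 ↔
      ∀ α, (∀ β, B α β = 0) → ∃ c : K, α = c • ξ := by
  let ev : Module.Dual K (Module.Dual K V) := Module.Dual.eval K V X
  -- `B` alone is never non-degenerate, since `ξ` lies in its radical; the square of evaluation at
  -- `X` fills exactly this direction.
  let C : LinearMap.BilinForm K (Module.Dual K V) := B + (LinearMap.mul K K).compl₁₂ ev ev
  have hC (α β) : C α β = B α β + α X * β X := rfl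
  have hM : (Matrix.of fun i j => B (b i) (b j) + b i X * b j X) =
      LinearMap.toMatrix₂ b b C := by
    ext i j
    rw [LinearMap.toMatrix₂_apply, hC, Matrix.of_apply]
  rw [hM, ← LinearMap.separatingLeft_iff_det_ne_zero]
  constructor
  · intro h α hα
    refine ⟨α X, sub_eq_zero.1 (h _ fun β => ?_)⟩
    simp [hC, hα, hBξ, hX]
  · intro h α hα
    have h0 : α X = 0 := by
      have h1 := hα ξ
      rwa [hC, neg_swap_of_alt hB, hBξ, hX, neg_zero, zero_add, mul_one] at h1
    obtain ⟨c, rfl⟩ := h α fun β => by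
      have h1 := hα β
      rwa [hC, h0, zero_mul, add_zero] at h1
    rw [LinearMap.smul_apply, hX, smul_eq_mul, mul_one] at h0
    rw [h0, zero_smul]

theorem normalBivec_one_radical {f : Module.Basis (Fin 7) K V} {α : Module.Dual K V}
    (h : ∀ β, normalBivec 1 f α β = 0) : ∃ c : K, α = c • f.coord 6 := by
  refine ⟨α (f 6), f.ext fun i => ?_⟩
  rw [LinearMap.smul_apply, coord_basis]
  have h0 := h (f.coord 0)
  have h1 := h (f.coord 1)
  have h2 := h (f.coord 2)
  have h3 := h (f.coord 3)
  have h4 := h (f.coord 4)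
  have h5 := h (f.coord 5)
  simp only [normalBivec_apply, coord_basis, Fin.reduceEq, if_true, if_false, mul_one, mul_zero,
    one_mul, add_zero, zero_add, sub_zero, zero_sub, neg_eq_zero] at h0 h1 h2 h3 h4 h5
  fin_cases i <;> simp [*]

theorem pfaffian4_normalBivec (c : K) (f : Module.Basis (Fin 7) K V) :
    pfaffian4 (normalBivec c f) (f.coord 0) (f.coord 1) (f.coord 2) (f.coord 3) = 1 := by
  simp [pfaffian4, normalBivec_apply]

end Radical

/-! ### Base change of covectors, kernels and bivectors to `ℂ`. -/

section Complexification
variable {V : Type*} [AddCommGroup V] [Module ℝ V]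

theorem baseChange_comp_baseChange (θ : Module.Dual ℝ V) (A : V →ₗ[ℝ] V) :
    θ.baseChange ℂ ∘ₗ A.baseChange ℂ = Module.Dual.baseChange ℂ (θ ∘ₗ A) := by
  ext
  simp

theorem exists_eq_baseChange_add (θ : Module.Dual ℂ (ℂ ⊗[ℝ] V)) :
    ∃ a b : Module.Dual ℝ V, θ = a.baseChange ℂ + Complex.I • b.baseChange ℂ := by
  let r : V →ₗ[ℝ] ℂ := θ.restrictScalars ℝ ∘ₗ TensorProduct.mk ℝ ℂ V 1
  refine ⟨Complex.reLm ∘ₗ r, Complex.imLm ∘ₗ r, ?_⟩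
  ext v
  simp [r, mul_comm Complex.I, Complex.re_add_im]

theorem coord_baseChange {ι : Type*} (f : Module.Basis ι ℝ V) (i : ι) :
    (f.baseChange ℂ).coord i = Module.Dual.baseChange ℂ (f.coord i) := by
  ext
  simp

theorem ker_baseChange {ξ : Module.Dual ℝ V} {X : V} (hX : ξ X = 1) :
    LinearMap.ker (ξ.baseChange ℂ) = (LinearMap.ker ξ).baseChange ℂ := by
  apply le_antisymm
  · have key (w : ℂ ⊗[ℝ] V) :
        w - ξ.baseChange ℂ w ⊗ₜ[ℝ] X ∈ (LinearMap.ker ξ).baseChange ℂ := by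
      induction w using TensorProduct.induction_on with
      | zero => simp
      | tmul z v =>
        have h : z ⊗ₜ[ℝ] v - ξ.baseChange ℂ (z ⊗ₜ[ℝ] v) ⊗ₜ[ℝ] X = z ⊗ₜ[ℝ] (v - ξ v • X) := by
          rw [Module.Dual.baseChange_apply_tmul, TensorProduct.tmul_sub, TensorProduct.smul_tmul]
        rw [h]
        exact Submodule.tmul_mem_baseChange_of_mem _ (by simp [hX])
      | add x y hx hy =>
        rw [map_add, TensorProduct.add_tmul, add_sub_add_comm]
        exact add_mem hx hy
    intro w hw
    have h := key w
    rwa [LinearMap.mem_ker.1 hw, TensorProduct.zero_tmul, sub_zero] at h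
  · rw [Submodule.baseChange_eq_span, Submodule.span_le]
    rintro _ ⟨u, hu, rfl⟩
    have hu' : ξ u = 0 := hu
    simp [hu']

theorem HasNormalForm.baseChange {c : ℝ} {A : V →ₗ[ℝ] V} {ξ : Module.Dual ℝ V}
    (h : HasNormalForm c A ξ) : HasNormalForm (c : ℂ) (A.baseChange ℂ) (ξ.baseChange ℂ) := by
  obtain ⟨f, rfl, h⟩ := h
  have : Module.Finite ℝ V := Module.Finite.of_basis f
  let F := f.baseChange ℂ
  let B := normalBivec (c : ℂ) F
  have hB (α β : Module.Dual ℝ V) :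
      B (α.baseChange ℂ) (β.baseChange ℂ) = (normalBivec c f α β : ℝ) := by
    simp [B, F, normalBivec_apply]
  refine ⟨F, (coord_baseChange f 6).symm, ⟨fun α => ?_, fun β => ?_, ?_⟩⟩
  · rw [normalBivec_apply]
    ring
  · rw [← coord_baseChange]
    change normalBivec (c : ℂ) F (F.coord 6) β = 0
    rw [normalBivec_apply]
    simp only [coord_basis, Fin.reduceEq, if_false]
    ring
  · have key : B ∘ₗ (A.baseChange ℂ).dualMap + B.compl₂ (A.baseChange ℂ).dualMap =
        LinearMap.trace ℂ _ (A.baseChange ℂ) • B := by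
      refine F.dualBasis.ext fun i => F.dualBasis.ext fun j => ?_
      have h1 := h.trace (f.coord i) (f.coord j)
      simp only [LinearMap.add_apply, LinearMap.comp_apply, LinearMap.compl₂_apply,
        LinearMap.smul_apply, LinearMap.dualMap_apply', Module.Basis.coe_dualBasis]
      rw [coord_baseChange, coord_baseChange, baseChange_comp_baseChange,
        baseChange_comp_baseChange, hB, hB, hB, LinearMap.trace_baseChange, ← Complex.ofReal_add,
        h1]
      simp
    exact fun α β => LinearMap.congr_fun₂ key α β

/-- The real bilinear form obtained by restriction to real covectors and applying `ρ`. -/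
def realForm (ρ : ℂ →ₗ[ℝ] ℝ) (B : LinearMap.BilinForm ℂ (Module.Dual ℂ (ℂ ⊗[ℝ] V))) :
    LinearMap.BilinForm ℝ (Module.Dual ℝ V) :=
  LinearMap.mk₂ ℝ (fun α β => ρ (B (α.baseChange ℂ) (β.baseChange ℂ)))
    (fun _ _ _ => by simp) (fun c _ _ => by rw [← map_smul ρ]; simp)
    (fun _ _ _ => by simp) (fun c _ _ => by rw [← map_smul ρ]; simp)

theorem realForm_apply (ρ : ℂ →ₗ[ℝ] ℝ)
    (B : LinearMap.BilinForm ℂ (Module.Dual ℂ (ℂ ⊗[ℝ] V))) (α β : Module.Dual ℝ V) :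
    realForm ρ B α β = ρ (B (α.baseChange ℂ) (β.baseChange ℂ)) := rfl

/-- The equation is linear in `B` and has real coefficients, the trace included, so any real-linear
functional on the values preserves it. -/
theorem IsTraceBivector.realForm [Module.Finite ℝ V] {A : V →ₗ[ℝ] V} {ξ : Module.Dual ℝ V}
    {B : LinearMap.BilinForm ℂ (Module.Dual ℂ (ℂ ⊗[ℝ] V))}
    (h : IsTraceBivector (A.baseChange ℂ) (ξ.baseChange ℂ) B) (ρ : ℂ →ₗ[ℝ] ℝ) :
    IsTraceBivector A ξ (realForm ρ B) where
  alt α := by rw [realForm_apply, h.alt, map_zero]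
  left β := by rw [realForm_apply, h.left, map_zero]
  trace α β := by
    simp only [realForm_apply]
    rw [← map_add, ← baseChange_comp_baseChange, ← baseChange_comp_baseChange, h.trace,
      LinearMap.trace_baseChange, Complex.coe_algebraMap, ← Complex.real_smul, map_smul,
      smul_eq_mul]

/-- The Pfaffian is complex-linear in each argument and real covectors span over `ℂ`; vanishing is
carried from real to complex covectors one slot at a time. -/
theorem exists_real_pfaffian4_ne_zero {B : LinearMap.BilinForm ℂ (Module.Dual ℂ (ℂ ⊗[ℝ] V))}
    {α β γ δ : Module.Dual ℂ (ℂ ⊗[ℝ] V)} (h : pfaffian4 B α β γ δ ≠ 0) :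
    ∃ a b c d : Module.Dual ℝ V, pfaffian4 B (a.baseChange ℂ) (b.baseChange ℂ) (c.baseChange ℂ)
      (d.baseChange ℂ) ≠ 0 := by
  by_contra! h0
  have h1 (α) (b c d : Module.Dual ℝ V) : pfaffian4 B α (b.baseChange ℂ) (c.baseChange ℂ)
      (d.baseChange ℂ) = 0 := by
    obtain ⟨x, y, rfl⟩ := exists_eq_baseChange_add α
    have hx := h0 x b c d
    have hy := h0 y b c d
    simp only [pfaffian4, map_add, map_smul, LinearMap.add_apply, LinearMap.smul_apply,
      smul_eq_mul] at hx hy ⊢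
    linear_combination hx + Complex.I * hy
  have h2 (α β) (c d : Module.Dual ℝ V) : pfaffian4 B α β (c.baseChange ℂ)
      (d.baseChange ℂ) = 0 := by
    obtain ⟨x, y, rfl⟩ := exists_eq_baseChange_add β
    have hx := h1 α x c d
    have hy := h1 α y c d
    simp only [pfaffian4, map_add, map_smul, LinearMap.add_apply, LinearMap.smul_apply,
      smul_eq_mul] at hx hy ⊢
    linear_combination hx + Complex.I * hy
  have h3 (α β γ) (d : Module.Dual ℝ V) : pfaffian4 B α β γ (d.baseChange ℂ) = 0 := by
    obtain ⟨x, y, rfl⟩ := exists_eq_baseChange_add γ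
    have hx := h2 α β x d
    have hy := h2 α β y d
    simp only [pfaffian4, map_add, map_smul, LinearMap.add_apply, LinearMap.smul_apply,
      smul_eq_mul] at hx hy ⊢
    linear_combination hx + Complex.I * hy
  obtain ⟨x, y, rfl⟩ := exists_eq_baseChange_add δ
  have hx := h3 α β γ x
  have hy := h3 α β γ y
  apply h
  simp only [pfaffian4, map_add, map_smul, smul_eq_mul] at hx hy ⊢
  linear_combination hx + Complex.I * hy

end Complexification

/-! ### Descent: a real parameter chosen by a polynomial argument. -/

section Polynomial
open Polynomial

theorem exists_real_eval_ne_zero {p : ℂ[X]} (hp : p ≠ 0) : ∃ t : ℝ, p.eval (t : ℂ) ≠ 0 := by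
  by_contra! h
  refine hp (p.eq_zero_of_infinite_isRoot ?_)
  refine (Set.infinite_range_of_injective Complex.ofReal_injective).mono ?_
  rintro _ ⟨t, rfl⟩
  exact h t

/-- The polynomial `re w + X im w`, with value `w` at `X = I`. -/
def linePoly (w : ℂ) : ℂ[X] := C (w.re : ℂ) + X * C (w.im : ℂ)

theorem eval_I_linePoly (w : ℂ) : (linePoly w).eval Complex.I = w := by
  simp [linePoly, Complex.re_add_im]

/-- The real functional `re + t im`. -/
def lineFunctional (t : ℝ) : ℂ →ₗ[ℝ] ℝ := Complex.reLm + t • Complex.imLm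

theorem eval_linePoly (t : ℝ) (w : ℂ) : (linePoly w).eval (t : ℂ) = (lineFunctional t w : ℝ) := by
  simp [linePoly, lineFunctional]
  ring

end Polynomial

section Descent
open Polynomial
variable {V : Type*} [AddCommGroup V] [Module ℝ V] {ι : Type*} [Fintype ι] [DecidableEq ι]

/-- The Pfaffian of the forms `realForm (lineFunctional t) B`, as a polynomial in `t`. -/
def pfaffianPoly (B : LinearMap.BilinForm ℂ (Module.Dual ℂ (ℂ ⊗[ℝ] V)))
    (a b c d : Module.Dual ℝ V) : ℂ[X] :=
  linePoly (B (a.baseChange ℂ) (b.baseChange ℂ)) * linePoly (B (c.baseChange ℂ) (d.baseChange ℂ))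
  - linePoly (B (a.baseChange ℂ) (c.baseChange ℂ)) *
    linePoly (B (b.baseChange ℂ) (d.baseChange ℂ))
  + linePoly (B (a.baseChange ℂ) (d.baseChange ℂ)) *
    linePoly (B (b.baseChange ℂ) (c.baseChange ℂ))

theorem eval_I_pfaffianPoly (B : LinearMap.BilinForm ℂ (Module.Dual ℂ (ℂ ⊗[ℝ] V)))
    (a b c d : Module.Dual ℝ V) :
    (pfaffianPoly B a b c d).eval Complex.I = pfaffian4 B (a.baseChange ℂ) (b.baseChange ℂ)
      (c.baseChange ℂ) (d.baseChange ℂ) := by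
  simp only [pfaffianPoly, eval_add, eval_sub, eval_mul, eval_I_linePoly, pfaffian4]

theorem eval_pfaffianPoly (B : LinearMap.BilinForm ℂ (Module.Dual ℂ (ℂ ⊗[ℝ] V)))
    (a b c d : Module.Dual ℝ V) (t : ℝ) :
    (pfaffianPoly B a b c d).eval (t : ℂ) =
      (pfaffian4 (realForm (lineFunctional t) B) a b c d : ℝ) := by
  simp only [pfaffianPoly, eval_add, eval_sub, eval_mul, eval_linePoly, pfaffian4, realForm_apply]
  push_cast
  ring

/-- The determinant of `realForm (lineFunctional t) B + X ⊗ X`, as a polynomial in `t`. -/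
def detPoly (B : LinearMap.BilinForm ℂ (Module.Dual ℂ (ℂ ⊗[ℝ] V)))
    (b : ι → Module.Dual ℝ V) (v : V) : ℂ[X] :=
  (Matrix.of fun i j => linePoly (B ((b i).baseChange ℂ) ((b j).baseChange ℂ)) +
    C ((b i v * b j v : ℝ) : ℂ)).det

theorem eval_detPoly' (B : LinearMap.BilinForm ℂ (Module.Dual ℂ (ℂ ⊗[ℝ] V)))
    (b : ι → Module.Dual ℝ V) (v : V) (z : ℂ) :
    (detPoly B b v).eval z = (Matrix.of fun i j =>
      (linePoly (B ((b i).baseChange ℂ) ((b j).baseChange ℂ))).eval z +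
        ((b i v * b j v : ℝ) : ℂ)).det := by
  rw [detPoly, ← coe_evalRingHom, RingHom.map_det]
  congr 1
  ext i j
  simp

theorem eval_detPoly (B : LinearMap.BilinForm ℂ (Module.Dual ℂ (ℂ ⊗[ℝ] V)))
    (b : ι → Module.Dual ℝ V) (v : V) (t : ℝ) :
    (detPoly B b v).eval (t : ℂ) = ((Matrix.of fun i j =>
      realForm (lineFunctional t) B (b i) (b j) + b i v * b j v).det : ℝ) := by
  have h (M : Matrix ι ι ℝ) : (M.det : ℂ) = (Complex.ofRealHom.mapMatrix M).det :=
    RingHom.map_det Complex.ofRealHom M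
  rw [eval_detPoly', h]
  congr 1
  ext i j
  simp [eval_linePoly, realForm_apply]

theorem HasNormalForm.of_baseChange (hV : Module.finrank ℝ V = 7) {A : V →ₗ[ℝ] V}
    {ξ : Module.Dual ℝ V} (hξ : ξ ≠ 0) {c : ℂ}
    (h : HasNormalForm c (A.baseChange ℂ) (ξ.baseChange ℂ)) :
    HasNormalForm 1 A ξ ∨ HasNormalForm 0 A ξ := by
  have : FiniteDimensional ℝ V := Module.finite_of_finrank_pos (by omega)
  obtain ⟨f, hf, h⟩ := h
  obtain ⟨α, β, γ, δ, h1⟩ := exists_real_pfaffian4_ne_zero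
    ((pfaffian4_normalBivec c f).symm ▸ one_ne_zero)
  rw [← eval_I_pfaffianPoly] at h1
  obtain ⟨t, ht⟩ := exists_real_eval_ne_zero
    (p := pfaffianPoly (normalBivec c f) α β γ δ) fun h2 => h1 (by rw [h2, eval_zero])
  rw [eval_pfaffianPoly, Complex.ofReal_ne_zero] at ht
  exact (h.realForm _).hasNormalForm hV hξ ht

theorem HasNormalForm.one_of_baseChange (hV : Module.finrank ℝ V = 7) {A : V →ₗ[ℝ] V}
    {ξ : Module.Dual ℝ V} {v : V} (hv : ξ v = 1)
    (h : HasNormalForm 1 (A.baseChange ℂ) (ξ.baseChange ℂ)) : HasNormalForm 1 A ξ := by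
  have : FiniteDimensional ℝ V := Module.finite_of_finrank_pos (by omega)
  have hξ : ξ ≠ 0 := fun h0 => by simp [h0] at hv
  obtain ⟨f, hf, h⟩ := h
  obtain ⟨α, β, γ, δ, h1⟩ := exists_real_pfaffian4_ne_zero
    ((pfaffian4_normalBivec 1 f).symm ▸ one_ne_zero)
  rw [← eval_I_pfaffianPoly] at h1
  let b := Module.finBasis ℝ V
  have hb (i) : (b.baseChange ℂ).dualBasis i = (b.dualBasis i).baseChange ℂ := by
    rw [Module.Basis.coe_dualBasis, Module.Basis.coe_dualBasis, coord_baseChange]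
  have h2 : (detPoly (normalBivec 1 f) b.dualBasis v).eval Complex.I ≠ 0 := by
    have h3 := (det_ne_zero_iff_radical (b.baseChange ℂ).dualBasis h.alt h.left
      (X := 1 ⊗ₜ[ℝ] v) (by simp [hv])).2 fun α hα => by
        rw [hf]
        exact normalBivec_one_radical hα
    rw [eval_detPoly']
    convert! h3 using 2
    ext i j
    simp only [Matrix.of_apply, hb, eval_I_linePoly]
    simp
  -- The product of the two polynomials is used so that a single real `t` keeps the Pfaffian and the
  -- determinant both non-zero.
  obtain ⟨t, ht⟩ := exists_real_eval_ne_zero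
    (p := pfaffianPoly (normalBivec 1 f) α β γ δ * detPoly (normalBivec 1 f) b.dualBasis v)
    fun h3 => mul_ne_zero h1 h2 (by rw [← eval_mul, h3, eval_zero])
  rw [eval_mul, eval_pfaffianPoly, eval_detPoly, ← Complex.ofReal_mul, Complex.ofReal_ne_zero] at ht
  have ht' := h.realForm (lineFunctional t)
  exact ht'.hasNormalForm_one hV hξ (left_ne_zero_of_mul ht)
    ((det_ne_zero_iff_radical b.dualBasis ht'.alt ht'.left hv).1 (right_ne_zero_of_mul ht))

end Descent

/-! ### The covector and derivation attached to the Abelian ideal. -/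

section Ideal
variable {K 𝔤 : Type*} [Field K] [LieRing 𝔤] [LieAlgebra K 𝔤]

/-- A codimension-one abelian ideal is the kernel of a covector `ξ`, and the Lie bracket is
determined by `ξ` and the adjoint action `A` of a vector `X` with `ξ X = 1`. -/
theorem exists_covector_of_abelian_ideal (hdim : Module.finrank K 𝔤 = 7) (𝔲 : LieIdeal K 𝔤)
    (habelian : IsLieAbelian 𝔲) (hdimu : Module.finrank K 𝔲 = 6) :
    ∃ (ξ : Module.Dual K 𝔤) (X : 𝔤) (A : 𝔤 →ₗ[K] 𝔤), ξ X = 1 ∧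
      𝔲.toSubmodule = LinearMap.ker ξ ∧ (∀ v w : 𝔤, ⁅v, w⁆ = ξ v • A w - ξ w • A v) ∧
      ∀ v, ξ (A v) = 0 := by
  have : FiniteDimensional K 𝔤 := Module.finite_of_finrank_pos (by omega)
  have hlt : 𝔲.toSubmodule < ⊤ := by
    refine lt_top_iff_ne_top.2 fun h => ?_
    have h1 : Module.finrank K 𝔲.toSubmodule = 6 := hdimu
    rw [h, finrank_top] at h1
    omega
  obtain ⟨ξ, hξ, hle⟩ := Submodule.exists_le_ker_of_lt_top _ hlt
  have hker : 𝔲.toSubmodule = LinearMap.ker ξ := by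
    refine Submodule.eq_of_le_of_finrank_eq hle ?_
    have h1 : Module.finrank K 𝔲.toSubmodule = 6 := hdimu
    have h2 := Module.Dual.finrank_ker_add_one_of_ne_zero hξ
    omega
  obtain ⟨v, hv⟩ : ∃ v, ξ v ≠ 0 := by
    by_contra! h
    exact hξ (LinearMap.ext h)
  let X := (ξ v)⁻¹ • v
  have hX : ξ X = 1 := by simp [X, hv]
  have hmem (w : 𝔤) : w ∈ 𝔲 ↔ ξ w = 0 := by
    rw [← LieSubmodule.mem_toSubmodule, hker, LinearMap.mem_ker]
  have hcomm (u w : 𝔤) (hu : u ∈ 𝔲) (hw : w ∈ 𝔲) : ⁅u, w⁆ = 0 :=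
    congrArg Subtype.val (habelian.trivial ⟨u, hu⟩ ⟨w, hw⟩)
  have hproj (w : 𝔤) : w - ξ w • X ∈ 𝔲 := (hmem _).2 (by simp [hX])
  have hXp (w : 𝔤) : ⁅X, w - ξ w • X⁆ = ⁅X, w⁆ := by simp
  refine ⟨ξ, X, (LieAlgebra.ad K 𝔤 X : 𝔤 →ₗ[K] 𝔤), hX, hker, fun v w => ?_, fun w => ?_⟩
  -- The components of `v` and `w` in `𝔲` along `X` commute; expanding this bracket leaves the
  -- asserted formula.
  · have h := hcomm _ _ (hproj v) (hproj w)
    simp only [sub_lie, lie_sub, smul_lie, lie_smul, lie_self, smul_zero, sub_zero] at h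
    rw [LieAlgebra.ad_apply, LieAlgebra.ad_apply, ← sub_eq_zero, ← h, ← lie_skew v X]
    module
  · rw [LieAlgebra.ad_apply, ← hXp, ← hmem]
    exact lie_mem_right K 𝔤 𝔲 _ _ (hproj w)

end Ideal

/-! ### Each kind of structure characterised by normal forms. -/

section Real
variable {𝔤 : Type*} [LieRing 𝔤] [LieAlgebra ℝ 𝔤] {ξ : Module.Dual ℝ 𝔤} {A : 𝔤 →ₗ[ℝ] 𝔤}

theorem lie_baseChange (hbr : ∀ v w : 𝔤, ⁅v, w⁆ = ξ v • A w - ξ w • A v)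
    (v w : ℂ ⊗[ℝ] 𝔤) : @Bracket.bracket _ _ LieRing.toBracket v w =
      ξ.baseChange ℂ v • A.baseChange ℂ w - ξ.baseChange ℂ w • A.baseChange ℂ v := by
  induction v using TensorProduct.induction_on with
  | zero => simp
  | add x y hx hy =>
    rw [add_lie, hx, hy, map_add, map_add]
    module
  | tmul a x =>
    induction w using TensorProduct.induction_on with
    | zero =>
      have h := LieRing.lie_add (a ⊗ₜ[ℝ] x) (0 : ℂ ⊗[ℝ] 𝔤) 0
      rw [add_zero, left_eq_add] at h
      rw [h]
      simp
    | add y z hy hz =>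
      rw [LieRing.lie_add, hy, hz, map_add, map_add]
      module
    | tmul b y =>
      have h : @Bracket.bracket (ℂ ⊗[ℝ] 𝔤) (ℂ ⊗[ℝ] 𝔤) LieRing.toBracket (a ⊗ₜ x) (b ⊗ₜ y) =
        (a * b) ⊗ₜ[ℝ] ⁅x, y⁆ := rfl
      rw [h, hbr]
      simp only [LinearMap.baseChange_tmul, Module.Dual.baseChange_apply_tmul,
        TensorProduct.smul_tmul', smul_eq_mul, TensorProduct.tmul_sub, smul_mul_assoc,
        TensorProduct.tmul_smul, mul_comm b a]

theorem baseChange_apply_baseChange (hA : ∀ v, ξ (A v) = 0) (v : ℂ ⊗[ℝ] 𝔤) :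
    ξ.baseChange ℂ (A.baseChange ℂ v) = 0 := by
  have h : ξ ∘ₗ A = 0 := LinearMap.ext hA
  have h1 := LinearMap.congr_fun (baseChange_comp_baseChange ξ A) v
  rwa [h, map_zero] at h1

theorem ne_zero_of_apply_eq_one {X : 𝔤} (hX : ξ X = 1) : ξ ≠ 0 := fun h => by simp [h] at hX

/-- Positive definiteness: this is why a `G₂`-structure only ever yields the rank-six normal form.
-/
theorem apply_sharp_one_ne_zero (e : Module.Basis (Fin 7) ℝ 𝔤) (hξ : ξ ≠ 0) :
    ξ (sharp 1 e ξ) ≠ 0 := by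
  have h : ξ (sharp 1 e ξ) = ∑ i, ξ (e i) * ξ (e i) := by simp [sharp, metricSign]
  rw [h]
  intro h0
  refine hξ (e.ext fun i => ?_)
  rw [Finset.sum_eq_zero_iff_of_nonneg fun i _ => mul_self_nonneg _] at h0
  exact mul_self_eq_zero.1 (h0 i (Finset.mem_univ i))


theorem admitsCocalibratedG2_iff_hasNormalForm (hdim : Module.finrank ℝ 𝔤 = 7)
    (hbr : ∀ v w : 𝔤, ⁅v, w⁆ = ξ v • A w - ξ w • A v) (hA : ∀ v, ξ (A v) = 0) (hξ : ξ ≠ 0) :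
    AdmitsCocalibratedG2 𝔤 ↔ HasNormalForm 1 A ξ := by
  have hs : (1 : ℤ) = 1 ∨ (1 : ℤ) = -1 := Or.inl rfl
  rw [admitsCocalibratedG2_iff hbr hA]
  constructor
  · rintro ⟨e, he⟩
    obtain ⟨α, β, γ, δ, h⟩ := exists_pfaffian4_phiBivec_ne_zero hs e hξ
    exact he.hasNormalForm_one hdim hξ h fun α hα =>
      phiBivec_radical hs e (apply_sharp_one_ne_zero e hξ) hα
  · intro h
    obtain ⟨e, he, -⟩ := h.exists_phiBivec hs
    exact ⟨e, he⟩

theorem admitsCocalibratedG2StarNondeg_iff_hasNormalForm (hdim : Module.finrank ℝ 𝔤 = 7)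
    (hbr : ∀ v w : 𝔤, ⁅v, w⁆ = ξ v • A w - ξ w • A v) (hA : ∀ v, ξ (A v) = 0) (hξ : ξ ≠ 0) :
    AdmitsCocalibratedG2StarNondeg 𝔤 (LinearMap.ker ξ) ↔ HasNormalForm 1 A ξ := by
  have hs : (-1 : ℤ) = 1 ∨ (-1 : ℤ) = -1 := Or.inr rfl
  rw [admitsCocalibratedG2StarNondeg_iff hbr hA hξ]
  constructor
  · rintro ⟨e, he, hq⟩
    obtain ⟨α, β, γ, δ, h⟩ := exists_pfaffian4_phiBivec_ne_zero hs e hξ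
    exact he.hasNormalForm_one hdim hξ h fun α hα => phiBivec_radical hs e hq hα
  · exact fun h => h.exists_phiBivec hs

theorem admitsCocalibratedG2Star_iff_hasNormalForm (hdim : Module.finrank ℝ 𝔤 = 7)
    (hbr : ∀ v w : 𝔤, ⁅v, w⁆ = ξ v • A w - ξ w • A v) (hA : ∀ v, ξ (A v) = 0) (hξ : ξ ≠ 0) :
    AdmitsCocalibratedG2Star 𝔤 ↔ HasNormalForm 1 A ξ ∨ HasNormalForm 0 A ξ := by
  have hs : (-1 : ℤ) = 1 ∨ (-1 : ℤ) = -1 := Or.inr rfl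
  rw [admitsCocalibratedG2Star_iff hbr hA]
  constructor
  · rintro ⟨e, he⟩
    obtain ⟨α, β, γ, δ, h⟩ := exists_pfaffian4_phiBivec_ne_zero hs e hξ
    exact he.hasNormalForm hdim hξ h
  · rintro (h | h)
    · obtain ⟨e, he, -⟩ := h.exists_phiBivec hs
      exact ⟨e, he⟩
    · exact h.exists_phiBivec_neg_one

end Real

section Complex
variable {𝔤 : Type*} [LieRing 𝔤] [LieAlgebra ℂ 𝔤] {ξ : Module.Dual ℂ 𝔤} {A : 𝔤 →ₗ[ℂ] 𝔤}

theorem admitsCocalibratedG2Complex_iff_hasNormalForm (hdim : Module.finrank ℂ 𝔤 = 7)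
    (hbr : ∀ v w : 𝔤, ⁅v, w⁆ = ξ v • A w - ξ w • A v) (hA : ∀ v, ξ (A v) = 0) (hξ : ξ ≠ 0) :
    AdmitsCocalibratedG2Complex 𝔤 ↔ HasNormalForm 1 A ξ ∨ HasNormalForm 0 A ξ := by
  have hs : (1 : ℤ) = 1 ∨ (1 : ℤ) = -1 := Or.inl rfl
  constructor
  · rintro ⟨φ, g, vol, h⟩
    obtain ⟨e, -, he⟩ := h.exists_basis hbr hA
    obtain ⟨α, β, γ, δ, h⟩ := exists_pfaffian4_phiBivec_ne_zero hs e hξ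
    exact he.hasNormalForm hdim hξ h
  · rintro (h | h)
    · obtain ⟨e, he, -⟩ := h.exists_phiBivec hs
      exact ⟨_, _, _, isCocalibratedG2Complex_phi_one hbr hA he⟩
    -- The rank-four case reuses the `G₂*` basis with null `ξ`, which over `ℂ` is also a
    -- `(G₂)_ℂ`-structure.
    · obtain ⟨e, he⟩ := h.exists_phiBivec_neg_one
      exact ⟨_, _, _, isCocalibratedG2Complex_phi_neg_one hbr hA he⟩

theorem admitsCocalibratedG2ComplexNondeg_iff_hasNormalForm (hdim : Module.finrank ℂ 𝔤 = 7)
    (hbr : ∀ v w : 𝔤, ⁅v, w⁆ = ξ v • A w - ξ w • A v) (hA : ∀ v, ξ (A v) = 0) (hξ : ξ ≠ 0) :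
    AdmitsCocalibratedG2ComplexNondeg 𝔤 (LinearMap.ker ξ) ↔ HasNormalForm 1 A ξ := by
  have hs : (1 : ℤ) = 1 ∨ (1 : ℤ) = -1 := Or.inl rfl
  constructor
  · rintro ⟨φ, g, vol, h, hnd⟩
    obtain ⟨e, rfl, he⟩ := h.exists_basis hbr hA
    obtain ⟨α, β, γ, δ, h⟩ := exists_pfaffian4_phiBivec_ne_zero hs e hξ
    exact he.hasNormalForm_one hdim hξ h fun α hα =>
      phiBivec_radical hs e ((metric_ker_nondegenerate_iff hs e hξ).1 hnd) hα
  · intro h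
    obtain ⟨e, he, hq⟩ := h.exists_phiBivec hs
    exact ⟨_, _, _, isCocalibratedG2Complex_phi_one hbr hA he,
      (metric_ker_nondegenerate_iff hs e hξ).2 hq⟩

end Complex
end CocalibratedG2

theorem mainTheorem8 {𝔤 : Type*} [LieRing 𝔤] [LieAlgebra ℝ 𝔤]
    (hdim : Module.finrank ℝ 𝔤 = 7) (𝔲 : LieIdeal ℝ 𝔤) (habelian : IsLieAbelian 𝔲)
    (hdimu : Module.finrank ℝ 𝔲 = 6) :
    (CocalibratedG2.AdmitsCocalibratedG2 𝔤 → CocalibratedG2.AdmitsCocalibratedG2Star 𝔤) ∧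
    (CocalibratedG2.AdmitsCocalibratedG2 𝔤 ↔
      CocalibratedG2.AdmitsCocalibratedG2StarNondeg 𝔤 𝔲.toSubmodule) ∧
    (CocalibratedG2.AdmitsCocalibratedG2Complex (ℂ ⊗[ℝ] 𝔤) ↔
      CocalibratedG2.AdmitsCocalibratedG2Star 𝔤) ∧
    (CocalibratedG2.AdmitsCocalibratedG2ComplexNondeg (ℂ ⊗[ℝ] 𝔤)
        (𝔲.toSubmodule.baseChange ℂ) ↔
      CocalibratedG2.AdmitsCocalibratedG2StarNondeg 𝔤 𝔲.toSubmodule) ∧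
    (CocalibratedG2.AdmitsCocalibratedG2ComplexNondeg (ℂ ⊗[ℝ] 𝔤)
        (𝔲.toSubmodule.baseChange ℂ) ↔
      CocalibratedG2.AdmitsCocalibratedG2 𝔤) := by
  obtain ⟨ξ, X, A, hX, hker, hbr, hA⟩ :=
    CocalibratedG2.exists_covector_of_abelian_ideal hdim 𝔲 habelian hdimu
  have hξ := CocalibratedG2.ne_zero_of_apply_eq_one hX
  have hdimC : Module.finrank ℂ (ℂ ⊗[ℝ] 𝔤) = 7 := by rw [Module.finrank_baseChange, hdim]
  have hbrC := CocalibratedG2.lie_baseChange hbr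
  have hAC := CocalibratedG2.baseChange_apply_baseChange hA
  have hXC : ξ.baseChange ℂ (1 ⊗ₜ[ℝ] X) = 1 := by simp [hX]
  have hξC : ξ.baseChange ℂ ≠ 0 := fun h => by simp [h] at hXC
  have h1 : CocalibratedG2.HasNormalForm 1 (A.baseChange ℂ) (ξ.baseChange ℂ) ↔
      CocalibratedG2.HasNormalForm 1 A ξ :=
    ⟨fun h => h.one_of_baseChange hdim hX, fun h => by simpa using h.baseChange⟩
  have h0 : CocalibratedG2.HasNormalForm 1 (A.baseChange ℂ) (ξ.baseChange ℂ) ∨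
      CocalibratedG2.HasNormalForm 0 (A.baseChange ℂ) (ξ.baseChange ℂ) ↔
      CocalibratedG2.HasNormalForm 1 A ξ ∨ CocalibratedG2.HasNormalForm 0 A ξ :=
    ⟨fun h => h.elim (fun h => h.of_baseChange hdim hξ) fun h => h.of_baseChange hdim hξ,
      fun h => h.imp h1.2 fun h => by simpa using h.baseChange⟩
  -- All conditions turn into the two normal-form conditions on `A` and `ξ`, and `h0`, `h1` identify
  -- these over `ℝ` and `ℂ`.
  rw [hker, ← CocalibratedG2.ker_baseChange hX,
    CocalibratedG2.admitsCocalibratedG2_iff_hasNormalForm hdim hbr hA hξ,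
    CocalibratedG2.admitsCocalibratedG2StarNondeg_iff_hasNormalForm hdim hbr hA hξ,
    CocalibratedG2.admitsCocalibratedG2Star_iff_hasNormalForm hdim hbr hA hξ,
    CocalibratedG2.admitsCocalibratedG2Complex_iff_hasNormalForm hdimC hbrC hAC hξC,
    CocalibratedG2.admitsCocalibratedG2ComplexNondeg_iff_hasNormalForm hdimC hbrC hAC hξC, h0, h1]
  exact ⟨Or.inl, Iff.rfl, Iff.rfl, Iff.rfl, Iff.rfl⟩

end
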